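/- Let $\kappa$ be a regular uncountable cardinal and let $X\supseteq\kappa$ be a set of ordinals. Write $P_\kappa X=\{x\subseteq X: |x|<\kappa\}$, $\kappa_x=|x\cap\kappa|$ for $x\in P_\kappa X$, and $x\prec y$ if $x\subseteq y$ and $|x|<\kappa_y$; thus $P_{\kappa_x}x=\{y : y\prec x\}$. *$\xi$-s-strong stationarity.* Let $x\in P_\kappa X$ and $A\subseteq P_\kappa X$. $A$ is $0$-s-strongly stationary in $P_{\kappa_x}x$ if $\kappa_x\neq 0$ and for every $y\in P_{\kappa_x}x$ there is $z\in A\cap P_{\kappa_x}x$ with $y\prec z$. For $\xi>0$, $A$ is $\xi$-s-strongly stationary in $P_{\kappa_x}x$ if $\kappa_x$ is a nonzero limit cardinal and, whenever $\zeta<\xi$ and $S,T\subseteq P_\kappa X$ are $\zeta$-s-strongly stationary in $P_{\kappa_x}x$, there is $y\in A\cap P_{\kappa_x}x$ such that $S$ and $T$ are both $\zeta$-s-strongly stationary in $P_{\kappa_y}y$. *Derived topologies.* For $x\prec y$ in $P_\kappa X$ let $(x,y]=\{z\in P_\kappa X: x\prec z\prec y\text{ or }z=y\}$. Let $\mathcal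 B_0$ consist of all $(x,y]$ with $x\prec y$ and all $\{x\}$ with $x\in P_\kappa X$, $x\cap\kappa=\emptyset$. Let $\tau_\xi$ be the topology on $P_\kappa X$ generated by $\mathcal B_\xi$, and $d_\xi(A)$ the set of limit points of $A$ in $(P_\kappa X,\tau_\xi)$, where $\mathcal B_{\xi+1}=\mathcal B_\xi\cup\{d_\xi(A): A\subseteq P_\kappa X\}$ and $\mathcal B_\xi=\bigcup_{\zeta<\xi}\mathcal B_\zeta$ for limit $\xi$. *Indescribability.* A $\Pi^1_0$ (equivalently $\Sigma^1_0$) formula is a formula without second-order quantifiers; a $\Pi^1_{\xi+1}$ (respectively $\Sigma^1_{\xi+1}$) formula is one of the form $\forall X_0\cdots\forall X_k\,\varphi$ with $\varphi$ a $\Sigma^1_\xi$ formula (respectively $\exists X_0\cdots\exists X_k\,\varphi$ with $\varphi$ a $\Pi^1_\xi$ formula); for limit $\xi$, a $\Pi^1_\xi$ (respectively $\Sigma^1_\xi$) formula is one of the form $\bigwedge_{\zeta<\xi}\varphi_\zeta$ with each $\varphi_\zeta$ a $\Pi^1_\zeta$ formula (respectively $\bigvee_{\zeta<\xi}\varphi_\zeta$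 with each $\varphi_\zeta$ a $\Sigma^1_\zeta$ formula) having only finitely many free second-order variables. Second-order variables are unary. For an uncountable regular cardinal $\mu$ and a set $Y$ of ordinals with $|Y|\ge\mu$ put $V_0(\mu,Y)=Y$, $V_{\alpha+1}(\mu,Y)=P_\mu(V_\alpha(\mu,Y))\cup V_\alpha(\mu,Y)$, and take unions at limits; the same recursion defines $V_\alpha(\mu,Y)$ for any cardinal $\mu$ and set $Y$. For $\xi<\mu$, a set $S\subseteq P_\mu Y$ is $\Pi^1_\xi$-indescribable in $P_\mu Y$ if for all $R_0,\dots,R_{n-1}\subseteq V_\mu(\mu,Y)$ and every $\Pi^1_\xi$ sentence $\varphi$ with $(V_\mu(\mu,Y),\in,R_0,\dots,R_{n-1})\models\varphi$ there is $y\in S$ such that $y\cap\mu$ is equal to the cardinal $\nu=|y\cap\mu|$ and $(V_{\nu}(\nu,y),\in,R_0\cap V_\nu(\nu,y),\dots,R_{n-1}\cap V_\nu(\nu,y))\models\varphi$. The set $P_\mu Y$ is called $\Pi^1_\xi$-indescribable if it is $\Pi^1_\xi$-indescribable in itself. **Corollary.** Let $\xi$ be an ordinal. (1) Let $x\in P_\kappa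 X$ with $\kappa_x=x\cap\kappa$ be such that $\kappa_x$ is regular uncountable and $\xi<\kappa_x$. If $A\subseteq P_{\kappa_x}x$ is $\Pi^1_\xi$-indescribable in $P_{\kappa_x}x$, then $A$ is $(\xi+1)$-s-strongly stationary in $P_{\kappa_x}x$. (2) If there is $x\in P_\kappa X$ such that $\kappa_x$ is regular uncountable, $\xi<\kappa_x$ and $P_{\kappa_x}x$ is $\Pi^1_\xi$-indescribable, then the topology $\tau_{\xi+1}$ on $P_\kappa X$ is not discrete. -/

import Mathlib

universe u

open Cardinal

noncomputable section

namespace TwoCardinal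

/-! ### `P_κ X`, the cardinals `κ_x` and the strong subset relation

Everything lives in `ZFSet`. A cardinal `κ` is identified, as a set, with the von Neumann ordinal
`κ.ord.toZFSet`. -/

/-- The cardinal `κ`, regarded as the set of all smaller von Neumann ordinals. -/
def cardSet (κ : Cardinal.{u}) : ZFSet.{u} := κ.ord.toZFSet

/-- `P_κ X`, the set of all subsets of `X` of cardinality less than `κ`. -/
def P (κ : Cardinal.{u}) (X : ZFSet.{u}) : ZFSet.{u} :=
  X.powerset.sep (fun x => x.card < κ)

/-- `κ_x = |x ∩ κ|`. -/
def kap (κ : Cardinal.{u}) (x : ZFSet.{u}) : Cardinal.{u} := (x ∩ cardSet κ).card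

/-- The strong subset relation `x ≺ y`: `x ⊆ y` and `|x| < κ_y`. -/
def StrongSubset (κ : Cardinal.{u}) (x y : ZFSet.{u}) : Prop :=
  x ⊆ y ∧ x.card < kap κ y

theorem mem_P {κ : Cardinal.{u}} {X x : ZFSet.{u}} : x ∈ P κ X ↔ x ⊆ X ∧ x.card < κ := by
  simp [P]

/-- `y ∈ P_{κ_x} x` if and only if `y ≺ x`. -/
theorem mem_P_kap {κ : Cardinal.{u}} {x y : ZFSet.{u}} :
    y ∈ P (kap κ x) x ↔ StrongSubset κ y x := mem_P

/-! ### Iterated strong stationarity -/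

/-- `A` is `≺`-cofinal in `P_{κ_x} x`. -/
def Cofinal (κ : Cardinal.{u}) (x : ZFSet.{u}) (A : Set ZFSet.{u}) : Prop :=
  ∀ y ∈ P (kap κ x) x, ∃ z ∈ A, z ∈ P (kap κ x) x ∧ StrongSubset κ y z

/-- `SStat κ X ξ x A`: the set `A` is `ξ`-s-strongly stationary in `P_{κ_x} x`, relative to the
ambient space `P_κ X`.

For `ξ = 0` this means that `κ_x ≠ 0` (that is, `P_{κ_x} x` is nonempty) and that `A` is
`≺`-cofinal in `P_{κ_x} x`. For `ξ > 0` it means that `κ_x` is a (nonzero, weak) limit cardinal and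
that for all `ζ < ξ`, any two `S, T ⊆ P_κ X` that are `ζ`-s-strongly stationary in `P_{κ_x} x` are
both `ζ`-s-strongly stationary in `P_{κ_y} y` for some common `y ∈ A ∩ P_{κ_x} x`. -/
def SStat (κ : Cardinal.{u}) (X : ZFSet.{u}) (ξ : Ordinal.{u}) (x : ZFSet.{u})
    (A : Set ZFSet.{u}) : Prop :=
  (ξ = 0 → kap κ x ≠ 0 ∧ Cofinal κ x A) ∧
  (ξ ≠ 0 → Order.IsSuccLimit (kap κ x) ∧
    ∀ ζ : Ordinal.{u}, ∀ _h : ζ < ξ, ∀ S T : Set ZFSet.{u},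
      S ⊆ {z | z ∈ P κ X} → T ⊆ {z | z ∈ P κ X} →
      SStat κ X ζ x S → SStat κ X ζ x T →
      ∃ y ∈ A, y ∈ P (kap κ x) x ∧ SStat κ X ζ y S ∧ SStat κ X ζ y T)
termination_by ξ

theorem sStat_zero {κ : Cardinal.{u}} {X x : ZFSet.{u}} {A : Set ZFSet.{u}} :
    SStat κ X 0 x A ↔ kap κ x ≠ 0 ∧ Cofinal κ x A := by
  rw [SStat]; simp

theorem sStat_of_ne_zero {κ : Cardinal.{u}} {X x : ZFSet.{u}} {ξ : Ordinal.{u}} (hξ : ξ ≠ 0)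
    {A : Set ZFSet.{u}} :
    SStat κ X ξ x A ↔ Order.IsSuccLimit (kap κ x) ∧
      ∀ ζ < ξ, ∀ S T : Set ZFSet.{u}, S ⊆ {z | z ∈ P κ X} → T ⊆ {z | z ∈ P κ X} →
        SStat κ X ζ x S → SStat κ X ζ x T →
        ∃ y ∈ A, y ∈ P (kap κ x) x ∧ SStat κ X ζ y S ∧ SStat κ X ζ y T := by
  rw [SStat]; simp [hξ]

/-! ### The derived topologies on `P_κ X` -/

/-- The underlying type of the space `P_κ X`. -/
abbrev Space (κ : Cardinal.{u}) (X : ZFSet.{u}) : Type (u + 1) := {x : ZFSet.{u} // x ∈ P κ X}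

/-- The half-open interval `(x, y] = {z ∈ P_κ X | x ≺ z ≺ y or z = y}`. -/
def interval (κ : Cardinal.{u}) (X : ZFSet.{u}) (x y : Space κ X) : Set (Space κ X) :=
  {z | (StrongSubset κ x.1 z.1 ∧ StrongSubset κ z.1 y.1) ∨ z = y}

/-- The base `B_0` of the topology `τ_0`: all intervals `(x, y]` with `x ≺ y`, together with the
singletons of the points `x` with `x ∩ κ = ∅` (for `X = κ` the only such point is `∅`). The points
`x` with `x ∩ κ = ∅` are exactly those that lie in no interval. -/
def base₀ (κ : Cardinal.{u}) (X : ZFSet.{u}) : Set (Set (Space κ X)) :=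
  {U | ∃ x : Space κ X, kap κ x.1 = 0 ∧ U = {x}} ∪
    {U | ∃ x y : Space κ X, StrongSubset κ x.1 y.1 ∧ U = interval κ X x y}

/-- The sets `B_ξ`: from `B_0`, by `B_{ξ+1} = B_ξ ∪ {d_ξ(A) | A ⊆ P_κ X}`, where `d_ξ(A)` is the set
of limit points of `A` in the topology generated by `B_ξ`, and by unions at limits. -/
def subbase (κ : Cardinal.{u}) (X : ZFSet.{u}) (ξ : Ordinal.{u}) : Set (Set (Space κ X)) :=
  Ordinal.limitRecOn (motive := fun _ => Set (Set (Space κ X))) ξ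
    (base₀ κ X)
    (fun _ B => B ∪
      Set.range (fun A : Set (Space κ X) => @derivedSet _ (TopologicalSpace.generateFrom B) A))
    (fun o _ B => ⋃ ζ : Set.Iio o, B ζ.1 ζ.2)

/-- The derived topology `τ_ξ` on `P_κ X`, generated by `B_ξ`. -/
abbrev tau (κ : Cardinal.{u}) (X : ZFSet.{u}) (ξ : Ordinal.{u}) : TopologicalSpace (Space κ X) :=
  TopologicalSpace.generateFrom (subbase κ X ξ)

/-- The Cantor derivative `d_ξ` of the space `(P_κ X, τ_ξ)`. -/
def cantor (κ : Cardinal.{u}) (X : ZFSet.{u}) (ξ : Ordinal.{u}) (A : Set (Space κ X)) :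
    Set (Space κ X) :=
  @derivedSet _ (tau κ X ξ) A

theorem subbase_zero (κ : Cardinal.{u}) (X : ZFSet.{u}) : subbase κ X 0 = base₀ κ X := by
  simp [subbase]

theorem subbase_add_one (κ : Cardinal.{u}) (X : ZFSet.{u}) (ξ : Ordinal.{u}) :
    subbase κ X (ξ + 1) = subbase κ X ξ ∪ Set.range (cantor κ X ξ) := by
  simp only [subbase, Ordinal.limitRecOn_add_one]; rfl

theorem subbase_limit (κ : Cardinal.{u}) (X : ZFSet.{u}) {ξ : Ordinal.{u}}
    (h : Order.IsSuccLimit ξ) : subbase κ X ξ = ⋃ ζ : Set.Iio ξ, subbase κ X ζ.1 := by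
  simp only [subbase, Ordinal.limitRecOn_limit _ _ _ _ h]

/-! ### The two-cardinal hierarchy `V_α(κ, X)` -/

/-- `V_0(κ, X) = X`, `V_{α+1}(κ, X) = P_κ(V_α(κ, X)) ∪ V_α(κ, X)`, and unions at limits. -/
def V (κ : Cardinal.{u}) (X : ZFSet.{u}) (α : Ordinal.{u}) : ZFSet.{u} :=
  Ordinal.limitRecOn (motive := fun _ => ZFSet.{u}) α
    X
    (fun _ W => P κ W ∪ W)
    (fun o _ W => ZFSet.iUnion (fun ζ : Set.Iio o => W ζ.1 ζ.2))

theorem V_zero (κ : Cardinal.{u}) (X : ZFSet.{u}) : V κ X 0 = X := by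
  simp [V]

theorem V_add_one (κ : Cardinal.{u}) (X : ZFSet.{u}) (α : Ordinal.{u}) :
    V κ X (α + 1) = P κ (V κ X α) ∪ V κ X α := by
  simp only [V, Ordinal.limitRecOn_add_one]

theorem V_limit (κ : Cardinal.{u}) (X : ZFSet.{u}) {α : Ordinal.{u}} (h : Order.IsSuccLimit α) :
    V κ X α = ZFSet.iUnion (fun ζ : Set.Iio α => V κ X ζ.1) := by
  simp only [V, Ordinal.limitRecOn_limit _ _ _ _ h]

/-- The top level `V_κ(κ, X)`. -/
def Vtop (κ : Cardinal.{u}) (X : ZFSet.{u}) : ZFSet.{u} := V κ X κ.ord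

/-! ### Second-order formulas and the classes `Π^1_ξ`, `Σ^1_ξ` -/

/-- Relation symbols of the language of set theory with `m` unary predicate symbols. -/
inductive SetRel (m : ℕ) : ℕ → Type
  | pred (i : Fin m) : SetRel m 1
  | mem : SetRel m 2

/-- The language `{∈, R_0, …, R_{m-1}}`, without function symbols. The unary predicate symbols play
the role both of the distinguished predicates and of free second-order variables. -/
def setLang (m : ℕ) : FirstOrder.Language := ⟨fun _ => Empty, SetRel m⟩

/-- The structure `(N, ∈, R_0, …, R_{m-1})`. -/
abbrev setStructure (N : ZFSet.{u}) {m : ℕ} (R : Fin m → Set N) : (setLang m).Structure N where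
  funMap := fun f => f.elim
  RelMap := fun r =>
    match r with
    | SetRel.pred i => fun v => v 0 ∈ R i
    | SetRel.mem => fun v => (v 0 : ZFSet.{u}) ∈ (v 1 : ZFSet.{u})

/-- Infinitary second-order formulas without free first-order variables and with `m` free (unary)
second-order variables `R_0, …, R_{m-1}`. A quantifier block binds the `k + 1` last variables.

Subformulas with free first-order variables occur only inside the first-order formulas `fo φ`: in a
sentence of the classes `IsPi`, `IsSigma` below, no first-order quantifier stands in front of a
second-order quantifier or of an infinitary connective. -/
inductive SOFormula : ℕ → Type (u + 1)
  | fo {m : ℕ} (φ : (setLang m).Sentence) : SOFormula m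
  | all {m : ℕ} (k : ℕ) (φ : SOFormula (m + (k + 1))) : SOFormula m
  | ex {m : ℕ} (k : ℕ) (φ : SOFormula (m + (k + 1))) : SOFormula m
  | conj {m : ℕ} (ξ : Ordinal.{u}) (φ : Set.Iio ξ → SOFormula m) : SOFormula m
  | disj {m : ℕ} (ξ : Ordinal.{u}) (φ : Set.Iio ξ → SOFormula m) : SOFormula m

/-- Satisfaction of a second-order formula in `(N, ∈, R_0, …, R_{m-1})`; second-order quantifiers
range over all subsets of `N`. -/
def SOFormula.Realize (N : ZFSet.{u}) : {m : ℕ} → SOFormula.{u} m → (Fin m → Set N) → Prop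
  | _, .fo φ, R => @FirstOrder.Language.Sentence.Realize _ N (setStructure N R) φ
  | _, .all k φ, R => ∀ Z : Fin (k + 1) → Set N, φ.Realize N (Fin.append R Z)
  | _, .ex k φ, R => ∃ Z : Fin (k + 1) → Set N, φ.Realize N (Fin.append R Z)
  | _, .conj _ φ, R => ∀ ζ, (φ ζ).Realize N R
  | _, .disj _ φ, R => ∃ ζ, (φ ζ).Realize N R

mutual

/-- The class of `Π^1_ξ` formulas: first-order formulas for `ξ = 0`; formulas
`∀ X_0 ⋯ ∀ X_k φ` with `φ` in `Σ^1_ξ` for `ξ + 1`; conjunctions `⋀_{ζ < ξ} φ_ζ` with every `φ_ζ`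
in `Π^1_ζ` for a limit `ξ`. -/
inductive IsPi : Ordinal.{u} → {m : ℕ} → SOFormula.{u} m → Prop
  | zero {m : ℕ} (φ : (setLang m).Sentence) : IsPi 0 (.fo φ)
  | succ {m : ℕ} {ξ : Ordinal.{u}} (k : ℕ) {φ : SOFormula.{u} (m + (k + 1))} :
      IsSigma ξ φ → IsPi (ξ + 1) (.all k φ)
  | limit {m : ℕ} {ξ : Ordinal.{u}} {φ : Set.Iio ξ → SOFormula.{u} m} :
      Order.IsSuccLimit ξ → (∀ ζ : Set.Iio ξ, IsPi ζ.1 (φ ζ)) → IsPi ξ (.conj ξ φ)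

/-- The class of `Σ^1_ξ` formulas, dual to `Π^1_ξ`. -/
inductive IsSigma : Ordinal.{u} → {m : ℕ} → SOFormula.{u} m → Prop
  | zero {m : ℕ} (φ : (setLang m).Sentence) : IsSigma 0 (.fo φ)
  | succ {m : ℕ} {ξ : Ordinal.{u}} (k : ℕ) {φ : SOFormula.{u} (m + (k + 1))} :
      IsPi ξ φ → IsSigma (ξ + 1) (.ex k φ)
  | limit {m : ℕ} {ξ : Ordinal.{u}} {φ : Set.Iio ξ → SOFormula.{u} m} :
      Order.IsSuccLimit ξ → (∀ ζ : Set.Iio ξ, IsSigma ζ.1 (φ ζ)) → IsSigma ξ (.disj ξ φ)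

end

/-- `(N, ∈, R_0 ∩ N, …, R_{n-1} ∩ N) ⊨ φ`. -/
def Models (N : ZFSet.{u}) {n : ℕ} (R : Fin n → Set ZFSet.{u}) (φ : SOFormula.{u} n) : Prop :=
  φ.Realize N (fun i => {a : N | (a : ZFSet.{u}) ∈ R i})

/-- For an uncountable regular cardinal `κ`, a set `X` with `|X| ≥ κ` and `ξ < κ`: the set
`S ⊆ P_κ X` is `Π^1_ξ`-indescribable in `P_κ X`, that is, whenever a `Π^1_ξ` sentence `φ` holds in
`(V_κ(κ, X), ∈, R_0, …, R_{n-1})`, there is `x ∈ S` with `x ∩ κ = κ_x` such that `φ` holds in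
`(V_{κ_x}(κ_x, x), ∈, R_0 ∩ V_{κ_x}(κ_x, x), …, R_{n-1} ∩ V_{κ_x}(κ_x, x))`. -/
def Indescribable (κ : Cardinal.{u}) (X : ZFSet.{u}) (ξ : Ordinal.{u}) (S : Set ZFSet.{u}) : Prop :=
  κ.IsRegular ∧ ℵ₀ < κ ∧ κ ≤ X.card ∧ ξ < κ.ord ∧ S ⊆ {x | x ∈ P κ X} ∧
    ∀ (n : ℕ) (R : Fin n → Set ZFSet.{u}) (φ : SOFormula.{u} n),
      (∀ i, R i ⊆ {a | a ∈ Vtop κ X}) → IsPi ξ φ → Models (Vtop κ X) R φ →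
      ∃ x ∈ S, x ∩ cardSet κ = cardSet (kap κ x) ∧ Models (Vtop (kap κ x) x) R φ

end TwoCardinal

end

noncomputable section

namespace TwoCardinal

open FirstOrder.Language

-- Write `μ` for `κ_x`. Indescribability yields stationarity because, for `ζ ≤ ξ`, the
-- ζ-stationarity of `S` in `P_μ x` can be expressed by a Π^1_ξ formula over `V_μ(μ, x)` with
-- finitely many predicates (`statDefinable`). The quantifier count works because stationarity at
-- points strictly below `x` is supplied as a predicate: the existence of a common reflection point
-- is then first-order, and passing from `ζ` to `ζ + 1` costs one universal block over an index and
-- two sets. If `S` and `T` are ζ-stationary at `x`, the conjunction of the two formulas reflects to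
-- some `y ∈ A`, where they again express stationarity (`Indescribable.exists_sStat`). This is what
-- (ξ+1)-stationarity of `A` asks for.
--
-- Two points need care. First, the formula classes are strict: there are no free conjunctions, and
-- limit formulas have finitely many free variables. A semantic hierarchy `PiPred` with the needed
-- closure properties is used and translated back by `PiPred.exists_formula`. The index is itself a
-- second-order variable, so one formula serves all indices up to `ζ`; at a limit each conjunct
-- treats an initial segment of indices, singled out without parameters by `leDefinable_or`. Second,
-- `V_ν(ν, y)` need not be transitive, but it is correct about sets of size below `μ`
-- (`Candidate.small`); reflecting closure under `c ↦ 2 ^ c` makes `ν` a strong limit, so that small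
-- families of sets are elements of the structure.
--
-- For the topology, the limit points of `A` in `τ_ξ` are exactly the points where `A` is
-- ξ-stationary (`mem_cantor_iff_sStat`), the combinatorial core being `SStat.inter`. Hence a point
-- carrying a (ξ+1)-stationary set is not isolated in `τ_{ξ+1}`. In part (2) `x ∩ κ` need not be a
-- cardinal, so stationarity is proved at the point `x₀ = κ_x`, a subset of `x` by
-- `Indescribable.cardSet_subset`, with the traces `y ∩ x₀` in place of `y`.

-- Renaming and dualizing second-order formulas

/-- The language inclusion induced by a renaming of the predicate symbols. -/
def renameHom {m m' : ℕ} (g : Fin m → Fin m') : setLang m →ᴸ setLang m' where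
  onFunction := fun _ f => f
  onRelation := fun _ r =>
    match r with
    | SetRel.pred i => SetRel.pred (g i)
    | SetRel.mem => SetRel.mem

theorem renameHom_isExpansionOn (N : ZFSet.{u}) {m m' : ℕ} (g : Fin m → Fin m')
    (R : Fin m' → Set N) :
    @LHom.IsExpansionOn _ _ (renameHom g) N (setStructure N (R ∘ g)) (setStructure N R) := by
  let := setStructure N (R ∘ g)
  let := setStructure N R
  refine @LHom.IsExpansionOn.mk _ _ _ _ _ _ (fun f => f.elim) ?_
  intro n r v
  cases r <;> rfl

/-- The map on blocks of variables that renames the free ones and fixes the bound ones. -/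
def liftRename {m m' : ℕ} (g : Fin m → Fin m') (k : ℕ) : Fin (m + k) → Fin (m' + k) :=
  Fin.addCases (fun i => Fin.castAdd k (g i)) (fun i => Fin.natAdd m' i)

theorem append_comp_liftRename {α : Type*} {m m' k : ℕ} (g : Fin m → Fin m') (R : Fin m' → α)
    (Z : Fin k → α) : Fin.append R Z ∘ liftRename g k = Fin.append (R ∘ g) Z := by
  funext i
  refine Fin.addCases (fun i => ?_) (fun i => ?_) i <;> simp [liftRename]

/-- Renaming of the free second-order variables. -/
def SOFormula.rename : {m m' : ℕ} → (Fin m → Fin m') → SOFormula.{u} m → SOFormula.{u} m'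
  | _, _, g, .fo φ => .fo ((renameHom g).onSentence φ)
  | _, _, g, .all k φ => .all k (φ.rename (liftRename g (k + 1)))
  | _, _, g, .ex k φ => .ex k (φ.rename (liftRename g (k + 1)))
  | _, _, g, .conj ξ φ => .conj ξ fun ζ => (φ ζ).rename g
  | _, _, g, .disj ξ φ => .disj ξ fun ζ => (φ ζ).rename g

theorem SOFormula.realize_rename (N : ZFSet.{u}) {m : ℕ} (φ : SOFormula.{u} m) :
    ∀ {m' : ℕ} (g : Fin m → Fin m') (R : Fin m' → Set N),
      (φ.rename g).Realize N R ↔ φ.Realize N (R ∘ g) := by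
  induction φ with
  | fo φ =>
    intro m' g R
    let := setStructure N (R ∘ g)
    let := setStructure N R
    have := renameHom_isExpansionOn N g R
    exact LHom.realize_onSentence N (renameHom g) φ
  | all k φ ih =>
    intro m' g R
    simp only [rename, Realize, ih, append_comp_liftRename]
  | ex k φ ih =>
    intro m' g R
    simp only [rename, Realize, ih, append_comp_liftRename]
  | conj ξ φ ih =>
    intro m' g R
    simp only [rename, Realize, ih]
  | disj ξ φ ih =>
    intro m' g R
    simp only [rename, Realize, ih]

theorem SOFormula.rename_class {m : ℕ} (φ : SOFormula.{u} m) :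
    ∀ {m' : ℕ} (g : Fin m → Fin m') (ξ : Ordinal.{u}),
      (IsPi ξ φ → IsPi ξ (φ.rename g)) ∧ (IsSigma ξ φ → IsSigma ξ (φ.rename g)) := by
  induction φ with
  | fo φ =>
    intro m' g ξ
    constructor <;> intro h <;> cases h
    · exact .zero _
    · exact .zero _
  | all k φ ih =>
    intro m' g ξ
    refine ⟨fun h => ?_, fun h => by cases h⟩
    cases h with
    | succ _ h => exact .succ k ((ih _ _).2 h)
  | ex k φ ih =>
    intro m' g ξ
    refine ⟨fun h => (by cases h), fun h => ?_⟩
    cases h with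
    | succ _ h => exact .succ k ((ih _ _).1 h)
  | conj η φ ih =>
    intro m' g ξ
    refine ⟨fun h => ?_, fun h => by cases h⟩
    cases h with
    | limit hl h => exact .limit hl fun ζ => (ih ζ _ _).1 (h ζ)
  | disj η φ ih =>
    intro m' g ξ
    refine ⟨fun h => (by cases h), fun h => ?_⟩
    cases h with
    | limit hl h => exact .limit hl fun ζ => (ih ζ _ _).2 (h ζ)

/-- The dual of a formula, equivalent to its negation. -/
def SOFormula.dual : {m : ℕ} → SOFormula.{u} m → SOFormula.{u} m
  | _, .fo φ => .fo φ.not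
  | _, .all k φ => .ex k φ.dual
  | _, .ex k φ => .all k φ.dual
  | _, .conj ξ φ => .disj ξ fun ζ => (φ ζ).dual
  | _, .disj ξ φ => .conj ξ fun ζ => (φ ζ).dual

theorem SOFormula.realize_dual (N : ZFSet.{u}) {m : ℕ} (φ : SOFormula.{u} m) :
    ∀ R : Fin m → Set N, φ.dual.Realize N R ↔ ¬ φ.Realize N R := by
  induction φ with
  | fo φ =>
    intro R
    let := setStructure N R
    exact Sentence.realize_not N
  | all k φ ih => intro R; simp only [dual, Realize, ih, not_forall]
  | ex k φ ih => intro R; simp only [dual, Realize, ih, not_exists]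
  | conj ξ φ ih => intro R; simp only [dual, Realize, ih, not_forall]
  | disj ξ φ ih => intro R; simp only [dual, Realize, ih, not_exists]

theorem SOFormula.dual_class {m : ℕ} (φ : SOFormula.{u} m) :
    ∀ ξ : Ordinal.{u}, (IsPi ξ φ → IsSigma ξ φ.dual) ∧ (IsSigma ξ φ → IsPi ξ φ.dual) := by
  induction φ with
  | fo φ =>
    intro ξ
    constructor <;> intro h <;> cases h
    · exact .zero _
    · exact .zero _
  | all k φ ih =>
    intro ξ
    refine ⟨fun h => ?_, fun h => by cases h⟩
    cases h with
    | succ _ h => exact .succ k ((ih _).2 h)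
  | ex k φ ih =>
    intro ξ
    refine ⟨fun h => (by cases h), fun h => ?_⟩
    cases h with
    | succ _ h => exact .succ k ((ih _).1 h)
  | conj η φ ih =>
    intro ξ
    refine ⟨fun h => ?_, fun h => by cases h⟩
    cases h with
    | limit hl h => exact .limit hl fun ζ => (ih ζ _).1 (h ζ)
  | disj η φ ih =>
    intro ξ
    refine ⟨fun h => (by cases h), fun h => ?_⟩
    cases h with
    | limit hl h => exact .limit hl fun ζ => (ih ζ _).2 (h ζ)

/-! ### First-order definable predicates -/

/-- Predicates on structures `(N, ∈, R_0, R_1, …)` with `n` distinguished elements. -/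
abbrev FOPred (n : ℕ) : Type (u + 1) :=
  ∀ N : ZFSet.{u}, (ℕ → Set N) → (Fin n → N) → Prop

/-- `P` is uniformly first-order definable from finitely many of the predicates. -/
def FO (n : ℕ) (P : FOPred.{u} n) : Prop :=
  ∃ m : ℕ, ∀ m' ≥ m, ∃ φ : (setLang m').BoundedFormula Empty n,
    ∀ (N : ZFSet.{u}) (R : ℕ → Set N) (v : Fin n → N),
      @BoundedFormula.Realize _ N (setStructure N fun j : Fin m' => R j) _ _ φ default v ↔ P N R v

theorem FO.congr {n : ℕ} {P Q : FOPred.{u} n} (h : FO n P) (e : ∀ N R v, P N R v ↔ Q N R v) :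
    FO n Q := by
  obtain ⟨m, h⟩ := h
  refine ⟨m, fun m' hm => ?_⟩
  obtain ⟨φ, h⟩ := h m' hm
  exact ⟨φ, fun N R v => (h N R v).trans (e N R v)⟩

theorem FO.neg {n : ℕ} {P : FOPred.{u} n} (h : FO n P) : FO n fun N R v => ¬ P N R v := by
  obtain ⟨m, h⟩ := h
  refine ⟨m, fun m' hm => ?_⟩
  obtain ⟨φ, h⟩ := h m' hm
  refine ⟨φ.not, fun N R v => ?_⟩
  let := setStructure N fun j : Fin m' => R j
  exact BoundedFormula.realize_not.trans (not_congr (h N R v))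

theorem FO.and {n : ℕ} {P Q : FOPred.{u} n} (h : FO n P) (h' : FO n Q) :
    FO n fun N R v => P N R v ∧ Q N R v := by
  obtain ⟨m, h⟩ := h
  obtain ⟨m', h'⟩ := h'
  refine ⟨max m m', fun k hk => ?_⟩
  obtain ⟨φ, h⟩ := h k (le_trans (le_max_left _ _) hk)
  obtain ⟨ψ, h'⟩ := h' k (le_trans (le_max_right _ _) hk)
  refine ⟨φ ⊓ ψ, fun N R v => ?_⟩
  let := setStructure N fun j : Fin k => R j
  exact BoundedFormula.realize_inf.trans (and_congr (h N R v) (h' N R v))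

theorem FO.imp {n : ℕ} {P Q : FOPred.{u} n} (h : FO n P) (h' : FO n Q) :
    FO n fun N R v => P N R v → Q N R v :=
  (h.and h'.neg).neg.congr fun _ _ _ => by tauto

theorem FO.or {n : ℕ} {P Q : FOPred.{u} n} (h : FO n P) (h' : FO n Q) :
    FO n fun N R v => P N R v ∨ Q N R v :=
  (h.neg.and h'.neg).neg.congr fun _ _ _ => by tauto

theorem FO.iff {n : ℕ} {P Q : FOPred.{u} n} (h : FO n P) (h' : FO n Q) :
    FO n fun N R v => (P N R v ↔ Q N R v) :=
  ((h.imp h').and (h'.imp h)).congr fun _ _ _ => by tauto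

theorem FO.all {n : ℕ} {Q : ∀ N : ZFSet.{u}, (ℕ → Set N) → (Fin n → N) → N → Prop}
    (h : FO (n + 1) fun N R w => Q N R (fun j => w j.castSucc) (w (Fin.last n))) :
    FO n fun N R v => ∀ a, Q N R v a := by
  obtain ⟨m, h⟩ := h
  refine ⟨m, fun m' hm => ?_⟩
  obtain ⟨φ, h⟩ := h m' hm
  refine ⟨φ.all, fun N R v => ?_⟩
  let := setStructure N fun j : Fin m' => R j
  refine BoundedFormula.realize_all.trans (forall_congr' fun a => (h N R _).trans ?_)
  simp

theorem FO.ex {n : ℕ} {Q : ∀ N : ZFSet.{u}, (ℕ → Set N) → (Fin n → N) → N → Prop}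
    (h : FO (n + 1) fun N R w => Q N R (fun j => w j.castSucc) (w (Fin.last n))) :
    FO n fun N R v => ∃ a, Q N R v a :=
  (FO.all (Q := fun N R v a => ¬ Q N R v a) h.neg).neg.congr fun _ _ _ => not_forall_not

theorem FO.mem {n : ℕ} (i j : Fin n) :
    FO.{u} n fun _ _ v => (v i : ZFSet.{u}) ∈ (v j : ZFSet.{u}) := by
  refine ⟨0, fun m' _ => ⟨Relations.boundedFormula₂ (SetRel.mem : (setLang m').Relations 2)
    (Term.var (Sum.inr i)) (Term.var (Sum.inr j)), fun N R v => ?_⟩⟩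
  let := setStructure N fun j : Fin m' => R j
  exact BoundedFormula.realize_rel₂

theorem FO.eq {n : ℕ} (i j : Fin n) : FO.{u} n fun _ _ v => v i = v j := by
  refine ⟨0, fun m' _ => ⟨(Term.var (Sum.inr i)).bdEqual (Term.var (Sum.inr j)), fun N R v => ?_⟩⟩
  let := setStructure N fun j : Fin m' => R j
  exact BoundedFormula.realize_bdEqual _ _

theorem FO.pred {n : ℕ} (k : ℕ) (i : Fin n) : FO.{u} n fun _ R v => v i ∈ R k := by
  refine ⟨k + 1, fun m' hm => ⟨Relations.boundedFormula₁
    (SetRel.pred ⟨k, hm⟩ : (setLang m').Relations 1) (Term.var (Sum.inr i)), fun N R v => ?_⟩⟩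
  let := setStructure N fun j : Fin m' => R j
  exact BoundedFormula.realize_rel₁

theorem FO.rename {n : ℕ} {P : FOPred.{u} n} (h : FO n P) (f : ℕ → ℕ) :
    FO n fun N R v => P N (R ∘ f) v := by
  obtain ⟨m, h⟩ := h
  obtain ⟨φ, h⟩ := h m le_rfl
  refine ⟨(Finset.range m).sup f + 1, fun m' hm => ?_⟩
  have hf : ∀ j : Fin m, f j < m' := fun j =>
    lt_of_lt_of_le (Nat.lt_succ_of_le (Finset.le_sup (Finset.mem_range.2 j.2))) hm
  refine ⟨(renameHom fun j : Fin m => (⟨f j, hf j⟩ : Fin m')).onBoundedFormula φ, fun N R v => ?_⟩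
  refine Iff.trans ?_ (h N (R ∘ f) v)
  let _s := setStructure N fun j : Fin m' => R j
  have := renameHom_isExpansionOn N (fun j : Fin m => (⟨f j, hf j⟩ : Fin m')) fun j => R j
  let := setStructure N ((fun j : Fin m' => R j) ∘ fun j : Fin m => (⟨f j, hf j⟩ : Fin m'))
  exact LHom.realize_onBoundedFormula _ _

/-! ### A semantic hierarchy of predicates definable by `Π^1_ξ` formulas -/

/-- Predicates on structures `(N, ∈, R_0, R_1, …)`. -/
abbrev SOPred : Type (u + 1) := ∀ N : ZFSet.{u}, (ℕ → Set N) → Prop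

/-- `P` depends only on the first `m` second-order arguments. -/
def DependsOnFirst (m : ℕ) (P : SOPred.{u}) : Prop :=
  ∀ (N : ZFSet.{u}) (R R' : ℕ → Set N), (∀ j < m, R j = R' j) → (P N R ↔ P N R')

theorem DependsOnFirst.mono {m m' : ℕ} {P : SOPred.{u}} (h : DependsOnFirst m P) (hm : m ≤ m') :
    DependsOnFirst m' P :=
  fun N R R' e => h N R R' fun j hj => e j (hj.trans_le hm)

/-- The sequence with `R` at the even and `Z` at the odd positions. -/
def interleave {α : Type*} (R Z : ℕ → α) (j : ℕ) : α :=
  if j % 2 = 0 then R (j / 2) else Z (j / 2)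

@[simp]
theorem interleave_even {α : Type*} (R Z : ℕ → α) (j : ℕ) : interleave R Z (2 * j) = R j := by
  simp [interleave]

@[simp]
theorem interleave_odd {α : Type*} (R Z : ℕ → α) (j : ℕ) : interleave R Z (2 * j + 1) = Z j := by
  simp [interleave, Nat.add_mod, show (2 * j + 1) / 2 = j by omega]

theorem comp_interleave {α β : Type*} (f : α → β) (R Z : ℕ → α) :
    f ∘ interleave R Z = interleave (f ∘ R) (f ∘ Z) := by
  funext j
  simp only [Function.comp, interleave]
  split_ifs <;> rfl

/-- The predicates obtained from first-order ones by `ξ` alternations of second-order quantifiers,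
with conjunctions at limits; they are definable by `Π^1_ξ` formulas. -/
def PiPred (ξ : Ordinal.{u}) : Set SOPred.{u} :=
  Ordinal.limitRecOn (motive := fun _ => Set SOPred.{u}) ξ
    {P | FO 0 fun N R _ => P N R}
    (fun _ C => {P | ∃ Q ∈ C, ∀ N R, P N R ↔ ∀ Z, ¬ Q N (interleave R Z)})
    (fun o _ C => {P | ∃ (F : Ordinal.{u} → SOPred.{u}) (m : ℕ),
      (∀ ζ (h : ζ < o), F ζ ∈ C ζ h) ∧ (∀ ζ < o, DependsOnFirst m (F ζ)) ∧
        ∀ N R, P N R ↔ ∀ ζ < o, F ζ N R})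

theorem piPred_zero {P : SOPred.{u}} : P ∈ PiPred 0 ↔ FO 0 fun N R _ => P N R := by
  simp [PiPred]

theorem piPred_add_one {P : SOPred.{u}} {ξ : Ordinal.{u}} :
    P ∈ PiPred (ξ + 1) ↔ ∃ Q ∈ PiPred ξ, ∀ N R, P N R ↔ ∀ Z, ¬ Q N (interleave R Z) := by
  simp only [PiPred, Ordinal.limitRecOn_add_one]; rfl

theorem piPred_limit {P : SOPred.{u}} {ξ : Ordinal.{u}} (hξ : Order.IsSuccLimit ξ) :
    P ∈ PiPred ξ ↔ ∃ (F : Ordinal.{u} → SOPred.{u}) (m : ℕ),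
      (∀ ζ < ξ, F ζ ∈ PiPred ζ) ∧ (∀ ζ < ξ, DependsOnFirst m (F ζ)) ∧
        ∀ N R, P N R ↔ ∀ ζ < ξ, F ζ N R := by
  simp only [PiPred, Ordinal.limitRecOn_limit _ _ _ _ hξ]; rfl

theorem PiPred.congr {P Q : SOPred.{u}} {ξ : Ordinal.{u}} (h : P ∈ PiPred ξ)
    (e : ∀ N R, P N R ↔ Q N R) : Q ∈ PiPred ξ := by
  have : P = Q := by
    funext N R
    exact propext (e N R)
  rwa [← this]

/-- The renaming of variables that sends all variables but the first `m` to `0`. -/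
def clip (m j : ℕ) : ℕ := if j < m then j else 0

theorem DependsOnFirst.comp_clip {m : ℕ} {P : SOPred.{u}} (h : DependsOnFirst m P)
    (N : ZFSet.{u}) (R : ℕ → Set N) : P N (R ∘ clip m) ↔ P N R :=
  h N _ _ fun j hj => by simp [clip, hj]

theorem dependsOnFirst_clip (m : ℕ) (P : SOPred.{u}) :
    DependsOnFirst (m + 1) fun N R => P N (R ∘ clip m) := by
  intro N R R' e
  have : R ∘ clip m = R' ∘ clip m := by
    funext j
    refine e _ ?_
    unfold clip
    split_ifs <;> omega
  simp only [this]

/-- The bridge from the semantic hierarchy to syntax. At successors the negation in `PiPred` is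
realized by the dual formula, which exchanges the Π and Σ classes. -/
theorem PiPred.exists_formula {P : SOPred.{u}} {ξ : Ordinal.{u}} (h : P ∈ PiPred ξ) :
    ∃ (m : ℕ) (φ : SOFormula.{u} m), IsPi ξ φ ∧
      ∀ N R, φ.Realize N (fun j : Fin m => R j) ↔ P N R := by
  induction ξ using Ordinal.limitRecOn generalizing P with
  | zero =>
    obtain ⟨m, h⟩ := piPred_zero.1 h
    obtain ⟨φ, h⟩ := h m le_rfl
    refine ⟨m, .fo φ, .zero φ, fun N R => ?_⟩
    refine Iff.trans ?_ (h N R default)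
    let := setStructure N fun j : Fin m => R j
    simp only [SOFormula.Realize, FirstOrder.Language.Sentence.Realize,
      FirstOrder.Language.Formula.Realize]
  | add_one ξ ih =>
    obtain ⟨Q, hQ, e⟩ := piPred_add_one.1 h
    obtain ⟨m, φ, hφ, r⟩ := ih hQ
    let g : Fin m → Fin (m + (m + 1)) := fun j =>
      if (j : ℕ) % 2 = 0 then Fin.castAdd (m + 1) ⟨j / 2, by omega⟩
      else Fin.natAdd m ⟨j / 2, by omega⟩
    -- Interleaved position `j` becomes the free or the bound variable `j / 2`. Binding `m + 1`
    -- variables is more than enough and keeps the block nonempty when `m = 0`; the surplus ones are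
    -- dummies.
    refine ⟨m, .all m (φ.rename g).dual,
      .succ m (((φ.rename g).dual_class ξ).1 ((φ.rename_class g ξ).1 hφ)), fun N R => ?_⟩
    simp only [SOFormula.Realize, SOFormula.realize_dual, SOFormula.realize_rename, e]
    have key : ∀ Z : ℕ → Set N, Fin.append (fun j : Fin m => R j) (fun j : Fin (m + 1) => Z j) ∘ g
        = fun j : Fin m => interleave R Z j := by
      intro Z
      funext j
      simp only [Function.comp, g, interleave]
      split_ifs
      · exact Fin.append_left _ _ _
      · exact Fin.append_right _ _ _
    constructor
    · intro H Z
      have := H fun j => Z j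
      rwa [key, r] at this
    · intro H Z
      have := H fun j => if h : j < m + 1 then Z ⟨j, h⟩ else ∅
      rw [← r, ← key] at this
      convert this using 4
      funext j
      simp [Nat.lt_succ_iff.1 j.2]
  | limit ξ hξ ih =>
    obtain ⟨F, m, hF, hd, e⟩ := (piPred_limit hξ).1 h
    have : ∀ ζ : Set.Iio ξ, ∃ φ : SOFormula.{u} (m + 1), IsPi ζ.1 φ ∧
        ∀ N R, φ.Realize N (fun j : Fin (m + 1) => R j) ↔ F ζ N R := by
      intro ζ
      obtain ⟨k, φ, hφ, r⟩ := ih ζ.1 ζ.2 (hF ζ.1 ζ.2)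
      -- The number `k` of variables varies with `ζ`, while the conjunction needs one finite bound.
      -- Since `F ζ` ignores the variables from `m` on, they may all be identified with variable
      -- `0`.
      refine ⟨φ.rename fun j => ⟨clip m j, by unfold clip; split_ifs <;> omega⟩,
        (φ.rename_class _ _).1 hφ, fun N R => ?_⟩
      rw [SOFormula.realize_rename, ← (hd ζ ζ.2).comp_clip, ← r]
      rfl
    choose φ hφ r using this
    refine ⟨m + 1, .conj ξ φ, .limit hξ hφ, fun N R => ?_⟩
    simp only [SOFormula.Realize, r, e]
    exact ⟨fun H ζ h => H ⟨ζ, h⟩, fun H ζ => H ζ.1 ζ.2⟩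

theorem FO.exists_dependsOnFirst {P : SOPred.{u}} (h : FO 0 fun N R _ => P N R) :
    ∃ m, DependsOnFirst m P := by
  obtain ⟨m, h⟩ := h
  obtain ⟨φ, h⟩ := h m le_rfl
  refine ⟨m, fun N R R' e => ?_⟩
  have e' : (fun j : Fin m => R j) = fun j : Fin m => R' j := funext fun j => e j j.2
  exact (h N R default).symm.trans (by rw [e']; exact h N R' default)

theorem PiPred.rename {P : SOPred.{u}} {ξ : Ordinal.{u}} (h : P ∈ PiPred ξ) (f : ℕ → ℕ) :
    (fun N R => P N (R ∘ f)) ∈ PiPred ξ := by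
  induction ξ using Ordinal.limitRecOn generalizing P f with
  | zero => exact piPred_zero.2 ((piPred_zero.1 h).rename f)
  | add_one ξ ih =>
    obtain ⟨Q, hQ, e⟩ := piPred_add_one.1 h
    refine piPred_add_one.2 ⟨_, ih hQ (interleave (fun j => 2 * f j) fun j => 2 * j + 1),
      fun N R => ?_⟩
    simp only [e, comp_interleave]
    refine forall_congr' fun Z => ?_
    simp [Function.comp_def]
  | limit ξ hξ ih =>
    obtain ⟨F, m, hF, hd, e⟩ := (piPred_limit hξ).1 h
    refine (piPred_limit hξ).2 ⟨fun ζ N R => F ζ N (R ∘ f), (Finset.range m).sup f + 1,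
      fun ζ hζ => ih ζ hζ (hF ζ hζ) f, fun ζ hζ N R R' er => hd ζ hζ N _ _ fun j hj => er _ ?_,
      fun N R => e N _⟩
    exact Nat.lt_succ_of_le (Finset.le_sup (Finset.mem_range.2 hj))

theorem PiPred.fo {P : SOPred.{u}} (h : FO 0 fun N R _ => P N R) (ξ : Ordinal.{u}) :
    P ∈ PiPred ξ := by
  induction ξ using Ordinal.limitRecOn generalizing P with
  | zero => exact piPred_zero.2 h
  | add_one ξ ih =>
    refine piPred_add_one.2 ⟨_, ih (h.neg.rename (2 * ·)), fun N R => ?_⟩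
    simp [Function.comp_def]
  | limit ξ hξ ih =>
    obtain ⟨m, hd⟩ := h.exists_dependsOnFirst
    refine (piPred_limit hξ).2 ⟨fun _ => P, m, fun ζ hζ => ih ζ hζ h, fun _ _ => hd, fun N R => ?_⟩
    exact ⟨fun H _ _ => H, fun H => H 0 hξ.bot_lt⟩

/-- A first-order case distinction moves through a quantifier prefix unchanged, because both
branches can share the bound variables. -/
theorem PiPred.ite {F P Q : SOPred.{u}} {ξ : Ordinal.{u}} (hF : FO 0 fun N R _ => F N R)
    (hP : P ∈ PiPred ξ) (hQ : Q ∈ PiPred ξ) :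
    (fun N R => (F N R → P N R) ∧ (¬ F N R → Q N R)) ∈ PiPred ξ := by
  induction ξ using Ordinal.limitRecOn generalizing F P Q with
  | zero =>
    exact piPred_zero.2 ((hF.imp (piPred_zero.1 hP)).and (hF.neg.imp (piPred_zero.1 hQ)))
  | add_one ξ ih =>
    obtain ⟨P', hP', e⟩ := piPred_add_one.1 hP
    obtain ⟨Q', hQ', e'⟩ := piPred_add_one.1 hQ
    refine piPred_add_one.2 ⟨_, ih (hF.rename (2 * ·)) hP' hQ', fun N R => ?_⟩
    simp only [e, e', Function.comp_def, interleave_even]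
    by_cases hR : F N R <;> simp [hR]
  | limit ξ hξ ih =>
    obtain ⟨P', m, hP', hd, e⟩ := (piPred_limit hξ).1 hP
    obtain ⟨Q', m', hQ', hd', e'⟩ := (piPred_limit hξ).1 hQ
    obtain ⟨k, hk⟩ := hF.exists_dependsOnFirst
    refine (piPred_limit hξ).2 ⟨_, k + m + m', fun ζ hζ => ih ζ hζ hF (hP' ζ hζ) (hQ' ζ hζ),
      fun ζ hζ N R R' er => ?_, fun N R => ?_⟩
    · simp only [hk.mono (by omega : k ≤ k + m + m') N R R' er,
        (hd ζ hζ).mono (by omega : m ≤ k + m + m') N R R' er,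
        (hd' ζ hζ).mono (by omega : m' ≤ k + m + m') N R R' er]
    · simp only [e, e']
      by_cases hR : F N R <;> simp [hR]

/-- The guard `Nonempty N` is harmless in applications and allows to code a truth value by a set. -/
theorem PiPred.and {P Q : SOPred.{u}} {ξ : Ordinal.{u}} (hP : P ∈ PiPred ξ)
    (hQ : Q ∈ PiPred ξ) : (fun (N : ZFSet.{u}) R => (Nonempty N → P N R) ∧ Q N R) ∈ PiPred ξ := by
  induction ξ using Ordinal.limitRecOn generalizing P Q with
  | zero =>
    have hF : FO.{u} 0 fun (N : ZFSet.{u}) _ _ => ∃ a : N, a = a := FO.ex (FO.eq _ _)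
    exact piPred_zero.2 (((hF.imp (piPred_zero.1 hP)).and (piPred_zero.1 hQ)).congr
      fun N R v => by simp [nonempty_subtype])
  | add_one ξ _ =>
    obtain ⟨P', hP', e⟩ := piPred_add_one.1 hP
    obtain ⟨Q', hQ', e'⟩ := piPred_add_one.1 hQ
    -- the first bound variable decides which of the two conjuncts is tested
    let f : ℕ → ℕ := interleave (fun j => 2 * j) fun j => 2 * (j + 1) + 1
    have hF : FO.{u} 0 fun N R _ => ∃ a : N, a ∈ R 1 := FO.ex (FO.pred 1 _)
    refine piPred_add_one.2 ⟨_, PiPred.ite (F := fun N R => ∃ a : N, a ∈ R 1) hF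
      (PiPred.rename hP' f) (PiPred.rename hQ' f), fun N R => ?_⟩
    have key : ∀ Z : ℕ → Set N, interleave R Z ∘ f = interleave R fun j => Z (j + 1) := by
      intro Z
      simp only [f, comp_interleave]
      simp [Function.comp_def]
    have h1 : ∀ Z : ℕ → Set N, interleave R Z 1 = Z 0 := fun Z => interleave_odd R Z 0
    simp only [e, e', key, h1]
    constructor
    · rintro ⟨H, H'⟩ Z ⟨h, h'⟩
      by_cases hZ : ∃ a, a ∈ Z 0
      · exact H ⟨hZ.choose⟩ _ (h hZ)
      · exact H' _ (h' hZ)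
    · intro H
      constructor
      · rintro ⟨a⟩ Z h
        refine H (fun j => if j = 0 then {a} else Z (j - 1)) ⟨fun _ => by simpa using h, ?_⟩
        simp
      · intro Z h
        refine H (fun j => if j = 0 then ∅ else Z (j - 1)) ⟨?_, fun _ => by simpa using h⟩
        simp
  | limit ξ hξ ih =>
    obtain ⟨P', m, hP', hd, e⟩ := (piPred_limit hξ).1 hP
    obtain ⟨Q', m', hQ', hd', e'⟩ := (piPred_limit hξ).1 hQ
    refine (piPred_limit hξ).2 ⟨_, m + m', fun ζ hζ => ih ζ hζ (hP' ζ hζ) (hQ' ζ hζ),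
      fun ζ hζ N R R' er => ?_, fun N R => ?_⟩
    · simp only [(hd ζ hζ).mono (by omega : m ≤ m + m') N R R' er,
        (hd' ζ hζ).mono (by omega : m' ≤ m + m') N R R' er]
    · simp only [e, e']
      exact ⟨fun H ζ hζ => ⟨fun hN => H.1 hN ζ hζ, H.2 ζ hζ⟩,
        fun H => ⟨fun hN ζ hζ => (H ζ hζ).1 hN, fun ζ hζ => (H ζ hζ).2⟩⟩

theorem PiPred.all {Q : ∀ N : ZFSet.{u}, (ℕ → Set N) → (ℕ → Set N) → Prop} {ξ : Ordinal.{u}}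
    (h : (fun N R => Q N (fun j => R (2 * j)) fun j => R (2 * j + 1)) ∈ PiPred ξ) :
    (fun N R => ∀ Z, ¬ Q N R Z) ∈ PiPred (ξ + 1) :=
  piPred_add_one.2 ⟨_, h, fun N R => by simp⟩

theorem PiPred.not {P : SOPred.{u}} {ξ : Ordinal.{u}} (h : P ∈ PiPred ξ) :
    (fun N R => ¬ P N R) ∈ PiPred (ξ + 1) :=
  PiPred.congr (PiPred.all (Q := fun N R _ => P N R) (PiPred.rename h (2 * ·))) fun N R => by simp

/-- The cut by `clip m` enforces a common finite bound on the variables. It is harmless later, where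
the specifications of the `F ζ` involve only variables below `m`. -/
theorem PiPred.limit {F : Ordinal.{u} → SOPred.{u}} {ξ : Ordinal.{u}} (hξ : Order.IsSuccLimit ξ)
    (h : ∀ ζ < ξ, F ζ ∈ PiPred ζ) (m : ℕ) :
    (fun N R => ∀ ζ < ξ, F ζ N (R ∘ clip m)) ∈ PiPred ξ :=
  (piPred_limit hξ).2 ⟨fun ζ N R => F ζ N (R ∘ clip m), m + 1,
    fun ζ hζ => PiPred.rename (h ζ hζ) _, fun ζ _ => dependsOnFirst_clip m (F ζ), fun _ _ => Iff.rfl⟩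

/-! ### Cardinals as sets, and the hierarchy `V_α(κ, X)` -/

theorem toZFSet_mem_cardSet {μ : Cardinal.{u}} {α : Ordinal.{u}} :
    α.toZFSet ∈ cardSet μ ↔ α < μ.ord := by
  simp [cardSet]

theorem mem_cardSet {μ : Cardinal.{u}} {a : ZFSet.{u}} :
    a ∈ cardSet μ ↔ a.IsOrdinal ∧ a.card < μ := by
  constructor
  · intro h
    obtain ⟨α, hα, rfl⟩ := Ordinal.mem_toZFSet_iff.1 h
    exact ⟨ZFSet.isOrdinal_toZFSet α, by simpa using Cardinal.lt_ord.1 hα⟩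
  · rintro ⟨h, h'⟩
    rw [← h.toZFSet_rank_eq] at h' ⊢
    rw [toZFSet_mem_cardSet, Cardinal.lt_ord]
    simpa using h'

theorem card_cardSet (μ : Cardinal.{u}) : (cardSet μ).card = μ := by
  simp [cardSet]

theorem isOrdinal_cardSet (μ : Cardinal.{u}) : (cardSet μ).IsOrdinal :=
  ZFSet.isOrdinal_toZFSet _

theorem exists_subset_card_eq {s : ZFSet.{u}} {c : Cardinal.{u}} (h : c ≤ s.card) :
    ∃ t ⊆ s, t.card = c := by
  have h1 : lift.{u + 1} c ≤ #(s : Set ZFSet.{u}) := by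
    have := ZFSet.cardinalMk_coe_sort (x := s)
    exact (lift_le.2 h).trans this.ge
  obtain ⟨p, hp, hc⟩ := Cardinal.le_mk_iff_exists_subset.1 h1
  refine ⟨s.sep (· ∈ p), ZFSet.sep_subset, ?_⟩
  rw [← lift_inj.{u, u + 1}, ← hc, ← ZFSet.cardinalMk_coe_sort]
  have : ((s.sep (· ∈ p) : ZFSet.{u}) : Set ZFSet.{u}) = p := by
    ext z
    simpa using fun hz => hp hz
  exact congrArg (fun t : Set ZFSet.{u} => #t) this

theorem mem_V {ν : Cardinal.{u}} {y a : ZFSet.{u}} {α : Ordinal.{u}} :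
    a ∈ V ν y α ↔ a ∈ y ∨ ∃ β < α, a ∈ P ν (V ν y β) := by
  induction α using Ordinal.limitRecOn generalizing a with
  | zero => simp [V_zero]
  | add_one α ih =>
    rw [V_add_one, ZFSet.mem_union, ih]
    constructor
    · rintro (h | h | ⟨β, hβ, h⟩)
      · exact .inr ⟨α, by simp, h⟩
      · exact .inl h
      · exact .inr ⟨β, hβ.trans (by simp), h⟩
    · rintro (h | ⟨β, hβ, h⟩)
      · exact .inr (.inl h)
      · rcases (Order.lt_add_one_iff.1 hβ).eq_or_lt with rfl | hβ
        · exact .inl h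
        · exact .inr (.inr ⟨β, hβ, h⟩)
  | limit α hα ih =>
    rw [V_limit _ _ hα, ZFSet.mem_iUnion]
    constructor
    · rintro ⟨⟨β, hβ⟩, h⟩
      rcases (ih β hβ).1 h with h | ⟨γ, hγ, h⟩
      · exact .inl h
      · exact .inr ⟨γ, hγ.trans hβ, h⟩
    · rintro (h | ⟨β, hβ, h⟩)
      · exact ⟨⟨0, hα.bot_lt⟩, (ih 0 hα.bot_lt).2 (.inl h)⟩
      · have hβ' : β + 1 < α := hα.add_one_lt hβ
        exact ⟨⟨β + 1, hβ'⟩, (ih _ hβ').2 (.inr ⟨β, by simp, h⟩)⟩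

theorem P_mono {ν μ : Cardinal.{u}} {y x : ZFSet.{u}} (h : ν ≤ μ) (h' : y ⊆ x) : P ν y ⊆ P μ x := by
  intro a ha
  rw [mem_P] at ha ⊢
  exact ⟨ha.1.trans h', ha.2.trans_le h⟩

theorem V_mono {ν : Cardinal.{u}} {y : ZFSet.{u}} {α β : Ordinal.{u}} (h : α ≤ β) :
    V ν y α ⊆ V ν y β := by
  intro a ha
  rw [mem_V] at ha ⊢
  exact ha.imp_right fun ⟨γ, hγ, h'⟩ => ⟨γ, hγ.trans_le h, h'⟩

theorem V_subset_V {ν μ : Cardinal.{u}} {y x : ZFSet.{u}} (h : ν ≤ μ) (h' : y ⊆ x)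
    (α : Ordinal.{u}) : V ν y α ⊆ V μ x α := by
  induction α using WellFoundedLT.induction with
  | _ α ih =>
    intro a ha
    rw [mem_V] at ha ⊢
    exact ha.imp (fun h => h' h) fun ⟨γ, hγ, h''⟩ => ⟨γ, hγ, P_mono h (ih γ hγ) h''⟩

theorem Vtop_subset_Vtop {ν μ : Cardinal.{u}} {y x : ZFSet.{u}} (h : ν ≤ μ) (h' : y ⊆ x) :
    Vtop ν y ⊆ Vtop μ x :=
  (V_subset_V h h' _).trans (V_mono (ord_le_ord.2 h))

theorem subset_Vtop (ν : Cardinal.{u}) (y : ZFSet.{u}) : y ⊆ Vtop ν y :=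
  fun _ h => mem_V.2 (.inl h)

theorem mem_Vtop_of_subset_V {ν : Cardinal.{u}} {y a : ZFSet.{u}} {β : Ordinal.{u}}
    (hβ : β < ν.ord) (h : a ⊆ V ν y β) (h' : a.card < ν) : a ∈ Vtop ν y :=
  mem_V.2 (.inr ⟨β, hβ, mem_P.2 ⟨h, h'⟩⟩)

theorem P_subset_Vtop {ν : Cardinal.{u}} {y : ZFSet.{u}} : P ν y ⊆ Vtop ν y := by
  intro a ha
  rw [mem_P] at ha
  have hν : 0 < ν.ord := by
    rw [Cardinal.lt_ord]
    simpa using (zero_le).trans_lt ha.2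
  exact mem_Vtop_of_subset_V hν (by simpa [V_zero] using ha.1) ha.2

section Infinite

variable {ν : Cardinal.{u}} {y : ZFSet.{u}}

theorem exists_mem_V (hν : ℵ₀ ≤ ν) {a : ZFSet.{u}} (h : a ∈ Vtop ν y) :
    ∃ β < ν.ord, a ∈ V ν y β := by
  have hl := isSuccLimit_ord hν
  rw [Vtop, V_limit _ _ hl, ZFSet.mem_iUnion] at h
  obtain ⟨⟨β, hβ⟩, h⟩ := h
  exact ⟨β, hβ, h⟩

theorem unordered_pair_mem_Vtop (hν : ℵ₀ ≤ ν) {a b : ZFSet.{u}} (ha : a ∈ Vtop ν y)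
    (hb : b ∈ Vtop ν y) : ({a, b} : ZFSet.{u}) ∈ Vtop ν y := by
  obtain ⟨β, hβ, ha⟩ := exists_mem_V hν ha
  obtain ⟨γ, hγ, hb⟩ := exists_mem_V hν hb
  refine mem_Vtop_of_subset_V (max_lt hβ hγ) (fun c hc => ?_) ?_
  · rcases ZFSet.mem_pair.1 hc with rfl | rfl
    · exact V_mono (le_max_left _ _) ha
    · exact V_mono (le_max_right _ _) hb
  · refine ZFSet.card_insert_le.trans_lt (lt_of_lt_of_le ?_ hν)
    rw [ZFSet.card_singleton, one_add_one_eq_two]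
    exact natCast_lt_aleph0 (n := 2)

theorem pair_mem_Vtop (hν : ℵ₀ ≤ ν) {a b : ZFSet.{u}} (ha : a ∈ Vtop ν y)
    (hb : b ∈ Vtop ν y) : ZFSet.pair a b ∈ Vtop ν y := by
  have : ({a} : ZFSet.{u}) ∈ Vtop ν y := by
    rw [← ZFSet.pair_eq_singleton]
    exact unordered_pair_mem_Vtop hν ha ha
  exact unordered_pair_mem_Vtop hν this (unordered_pair_mem_Vtop hν ha hb)

theorem mem_Vtop_of_subset_P (hν : ℵ₀ ≤ ν) {s : ZFSet.{u}} (h : s ⊆ P ν y) (h' : s.card < ν) :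
    s ∈ Vtop ν y := by
  have h1 : (1 : Ordinal.{u}) < ν.ord := by
    rw [Cardinal.lt_ord]
    simpa using one_lt_aleph0.trans_le hν
  refine mem_Vtop_of_subset_V h1 (fun a ha => ?_) h'
  exact mem_V.2 (.inr ⟨0, zero_lt_one, by simpa [V_zero] using h ha⟩)

end Infinite

/-- `y` is a candidate for reflecting the structure on `V_μ(μ, x)`: the ordinal `y ∩ μ` is the
cardinal `ν`. -/
structure Candidate (μ : Cardinal.{u}) (x : ZFSet.{u}) (ν : Cardinal.{u}) (y : ZFSet.{u}) :
    Prop where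
  ordinals : ∀ a ∈ x, a.IsOrdinal
  subset : y ⊆ x
  inter : y ∩ cardSet μ = cardSet ν

namespace Candidate

variable {μ ν : Cardinal.{u}} {x y : ZFSet.{u}}

theorem le (h : Candidate μ x ν y) : ν ≤ μ := by
  rw [← card_cardSet ν, ← card_cardSet μ, ← h.inter]
  exact ZFSet.card_mono fun a ha => (ZFSet.mem_inter.1 ha).2

theorem cardSet_subset (h : Candidate μ x ν y) : cardSet ν ⊆ y := by
  rw [← h.inter]
  exact fun a ha => (ZFSet.mem_inter.1 ha).1

theorem mem_cardSet_iff (h : Candidate μ x ν y) {a : ZFSet.{u}} (ha : a ∈ y) :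
    a ∈ cardSet μ ↔ a ∈ cardSet ν := by
  rw [← h.inter, ZFSet.mem_inter]
  simp [ha]

/-- The structure `V_ν(ν, y)` is transitive with respect to its elements that are small in
`V_μ(μ, x)`, and it is correct about smallness. -/
theorem small (h : Candidate μ x ν y) {a : ZFSet.{u}} (ha : a ∈ Vtop ν y) (hc : a.card < μ) :
    a.card < ν ∧ a ⊆ Vtop ν y := by
  rcases mem_V.1 ha with h' | ⟨β, hβ, h'⟩
  · have hm : a ∈ cardSet ν :=
      (h.mem_cardSet_iff h').1 (mem_cardSet.2 ⟨h.ordinals a (h.subset h'), hc⟩)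
    refine ⟨(mem_cardSet.1 hm).2, fun b hb => subset_Vtop _ _ (h.cardSet_subset ?_)⟩
    exact (isOrdinal_cardSet ν).subset_of_mem hm hb
  · exact ⟨(mem_P.1 h').2, (mem_P.1 h').1.trans (V_mono hβ.le)⟩

/-- The hierarchy over `y` adds no new elements of `x`: a set added at a later level has size below
`ν`, and as an ordinal it then lies in `ν ⊆ y`. -/
theorem mem_of_mem (h : Candidate μ x ν y) {α : Ordinal.{u}} {a : ZFSet.{u}}
    (ha : a ∈ V ν y α) (hx : a ∈ x) : a ∈ y := by
  rcases mem_V.1 ha with h' | ⟨β, _, h'⟩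
  · exact h'
  · exact h.cardSet_subset (mem_cardSet.2 ⟨h.ordinals a hx, (mem_P.1 h').2⟩)

theorem mem_Vtop_and_mem_P (h : Candidate μ x ν y) {x₀ a : ZFSet.{u}} (hx₀ : x₀ ⊆ x) :
    a ∈ Vtop ν y ∧ a ∈ P μ x₀ ↔ a ∈ P ν (y ∩ x₀) := by
  constructor
  · rintro ⟨ha, hP⟩
    rw [mem_P] at hP ⊢
    obtain ⟨h1, h2⟩ := h.small ha hP.2
    refine ⟨fun b hb => ZFSet.mem_inter.2 ⟨?_, hP.1 hb⟩, h1⟩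
    exact h.mem_of_mem (h2 hb) (hx₀ (hP.1 hb))
  · intro ha
    exact ⟨P_subset_Vtop (P_mono le_rfl (fun b hb => (ZFSet.mem_inter.1 hb).1) ha),
      P_mono h.le (fun b hb => (ZFSet.mem_inter.1 hb).2) ha⟩

theorem mem_Vtop_and_mem_cardSet (h : Candidate μ x ν y) {a : ZFSet.{u}} :
    a ∈ Vtop ν y ∧ a ∈ cardSet μ ↔ a ∈ cardSet ν := by
  constructor
  · rintro ⟨ha, hc⟩
    rw [mem_cardSet] at hc ⊢
    exact ⟨hc.1, (h.small ha hc.2).1⟩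
  · intro ha
    exact ⟨subset_Vtop _ _ (h.cardSet_subset ha),
      (h.mem_cardSet_iff (h.cardSet_subset ha)).2 ha⟩

end Candidate

/-! ### Combinatorics of iterated strong stationarity -/

section Stationary

variable {κ : Cardinal.{u}} {X : ZFSet.{u}}

theorem kap_mono {x y : ZFSet.{u}} (h : x ⊆ y) : kap κ x ≤ kap κ y := by
  refine ZFSet.card_mono fun a ha => ?_
  rw [ZFSet.mem_inter] at ha ⊢
  exact ⟨h ha.1, ha.2⟩

theorem kap_le_card (x : ZFSet.{u}) : kap κ x ≤ x.card :=
  ZFSet.card_mono fun _ ha => (ZFSet.mem_inter.1 ha).1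

theorem StrongSubset.trans {x y z : ZFSet.{u}} (h : StrongSubset κ x y) (h' : StrongSubset κ y z) :
    StrongSubset κ x z :=
  ⟨h.1.trans h'.1, h.2.trans_le (kap_mono h'.1)⟩

theorem StrongSubset.ne {x y : ZFSet.{u}} (h : StrongSubset κ x y) : x ≠ y := by
  rintro rfl
  exact (h.2.trans_le (kap_le_card x)).false

theorem StrongSubset.mem_P {x y : ZFSet.{u}} (h : StrongSubset κ y x) (hx : x ∈ P κ X) :
    y ∈ P κ X := by
  rw [TwoCardinal.mem_P] at hx ⊢
  exact ⟨h.1.trans hx.1, (h.2.trans_le (kap_le_card x)).trans hx.2⟩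

theorem exists_strongSubset_of_lt {x a : ZFSet.{u}} (hx : ℵ₀ ≤ kap κ x) {c : Cardinal.{u}}
    (ha : StrongSubset κ a x) (hc : c < kap κ x) :
    ∃ z, StrongSubset κ z x ∧ a ⊆ z ∧ c ≤ kap κ z := by
  obtain ⟨t, ht, rfl⟩ := exists_subset_card_eq (s := x ∩ cardSet κ) hc.le
  refine ⟨a ∪ t, ⟨fun b hb => ?_, ?_⟩, fun b hb => ZFSet.mem_union.2 (.inl hb), ?_⟩
  · rcases ZFSet.mem_union.1 hb with hb | hb
    · exact ha.1 hb
    · exact (ZFSet.mem_inter.1 (ht hb)).1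
  · exact ZFSet.card_union_le.trans_lt (add_lt_of_lt hx ha.2 hc)
  · refine ZFSet.card_mono fun b hb => ?_
    exact ZFSet.mem_inter.2 ⟨ZFSet.mem_union.2 (.inr hb), (ZFSet.mem_inter.1 (ht hb)).2⟩

theorem exists_strongSubset_above {x a b : ZFSet.{u}} (hx : Order.IsSuccLimit (kap κ x))
    (ha : StrongSubset κ a x) (hb : StrongSubset κ b x) :
    ∃ z, StrongSubset κ z x ∧ StrongSubset κ a z ∧ StrongSubset κ b z := by
  have hx' := aleph0_le_of_isSuccLimit hx
  have hab : StrongSubset κ (a ∪ b) x := by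
    refine ⟨fun c hc => ?_, ZFSet.card_union_le.trans_lt (add_lt_of_lt hx' ha.2 hb.2)⟩
    exact (ZFSet.mem_union.1 hc).elim (fun h => ha.1 h) fun h => hb.1 h
  obtain ⟨z, hz, hz', hc⟩ := exists_strongSubset_of_lt hx' hab (hx.succ_lt hab.2)
  have hlt : (a ∪ b).card < kap κ z := (Order.lt_succ _).trans_le hc
  have h1 : a ⊆ a ∪ b := fun c hc => ZFSet.mem_union.2 (.inl hc)
  have h2 : b ⊆ a ∪ b := fun c hc => ZFSet.mem_union.2 (.inr hc)
  exact ⟨z, hz, ⟨h1.trans hz', (ZFSet.card_mono h1).trans_lt hlt⟩,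
    ⟨h2.trans hz', (ZFSet.card_mono h2).trans_lt hlt⟩⟩

theorem empty_strongSubset {x : ZFSet.{u}} (hx : kap κ x ≠ 0) : StrongSubset κ ∅ x :=
  ⟨ZFSet.empty_subset x, by simpa using pos_iff_ne_zero.2 hx⟩

/-- If `κ_x` is not a limit cardinal, then `x` has a set below that no `z ≺ x` exceeds. -/
theorem exists_strongSubset_maximal {x : ZFSet.{u}} (h0 : kap κ x ≠ 0)
    (h : ¬ Order.IsSuccLimit (kap κ x)) :
    ∃ a, StrongSubset κ a x ∧ ∀ z, StrongSubset κ a z → ¬ StrongSubset κ z x := by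
  rw [Order.not_isSuccLimit_iff, Order.not_isSuccPrelimit_iff] at h
  rcases h with h | ⟨c, hc⟩
  · exact absurd h.eq_bot h0
  · have hlt : c < kap κ x := hc.lt
    obtain ⟨t, ht, rfl⟩ := exists_subset_card_eq (s := x ∩ cardSet κ) hlt.le
    refine ⟨t, ⟨fun b hb => (ZFSet.mem_inter.1 (ht hb)).1, hlt⟩, fun z hz hz' => ?_⟩
    have h1 : z.card < Order.succ t.card := hc.succ_eq ▸ hz'.2
    exact ((Order.lt_succ_iff.1 h1).trans_lt hz.2).not_ge (kap_le_card z)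

/-- The set enters the definition only through witnesses strictly below `x`. -/
theorem SStat.congr {ξ : Ordinal.{u}} {x : ZFSet.{u}} {A B : Set ZFSet.{u}}
    (h : ∀ z, StrongSubset κ z x → (z ∈ A ↔ z ∈ B)) : SStat κ X ξ x A ↔ SStat κ X ξ x B := by
  suffices H : ∀ A B : Set ZFSet.{u}, (∀ z, StrongSubset κ z x → z ∈ A → z ∈ B) →
      SStat κ X ξ x A → SStat κ X ξ x B from
    ⟨H A B fun z hz => (h z hz).1, H B A fun z hz => (h z hz).2⟩
  intro A B h H
  rcases eq_or_ne ξ 0 with rfl | hξ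
  · rw [sStat_zero] at H ⊢
    refine ⟨H.1, fun y hy => ?_⟩
    obtain ⟨z, hz, hz', hyz⟩ := H.2 y hy
    exact ⟨z, h z (mem_P_kap.1 hz') hz, hz', hyz⟩
  · rw [sStat_of_ne_zero hξ] at H ⊢
    refine ⟨H.1, fun ζ hζ S T hS hT hS' hT' => ?_⟩
    obtain ⟨y, hy, hy', hyS⟩ := H.2 ζ hζ S T hS hT hS' hT'
    exact ⟨y, h y (mem_P_kap.1 hy') hy, hy', hyS⟩

theorem SStat.mono {ξ : Ordinal.{u}} {x : ZFSet.{u}} {A B : Set ZFSet.{u}}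
    (H : SStat κ X ξ x A) (h : A ⊆ B) : SStat κ X ξ x B := by
  rcases eq_or_ne ξ 0 with rfl | hξ
  · rw [sStat_zero] at H ⊢
    refine ⟨H.1, fun y hy => ?_⟩
    obtain ⟨z, hz, hz'⟩ := H.2 y hy
    exact ⟨z, h hz, hz'⟩
  · rw [sStat_of_ne_zero hξ] at H ⊢
    refine ⟨H.1, fun ζ hζ S T hS hT hS' hT' => ?_⟩
    obtain ⟨y, hy, hy'⟩ := H.2 ζ hζ S T hS hT hS' hT'
    exact ⟨y, h hy, hy'⟩

theorem sStat_zero_iff {x : ZFSet.{u}} {A : Set ZFSet.{u}} :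
    SStat κ X 0 x A ↔ kap κ x ≠ 0 ∧
      ∀ y, StrongSubset κ y x → ∃ z ∈ A, StrongSubset κ z x ∧ StrongSubset κ y z := by
  simp only [sStat_zero, Cofinal, mem_P_kap]

/-- The restriction of `S` and `T` to `P_κ X` can be dropped: everything strictly below a point of
`P_κ X` is again in `P_κ X`. -/
theorem sStat_pos_iff {ξ : Ordinal.{u}} (hξ : ξ ≠ 0) {x : ZFSet.{u}} (hx : x ∈ P κ X)
    {A : Set ZFSet.{u}} :
    SStat κ X ξ x A ↔ Order.IsSuccLimit (kap κ x) ∧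
      ∀ ζ < ξ, ∀ S T : Set ZFSet.{u}, SStat κ X ζ x S → SStat κ X ζ x T →
        ∃ y ∈ A, StrongSubset κ y x ∧ SStat κ X ζ y S ∧ SStat κ X ζ y T := by
  rw [sStat_of_ne_zero hξ]
  refine and_congr_right fun _ => ⟨fun H ζ hζ S T hS hT => ?_, fun H ζ hζ S T _ _ hS hT => ?_⟩
  · have key : ∀ S : Set ZFSet.{u}, ∀ y ∈ P κ X,
        (SStat κ X ζ y (S ∩ {z | z ∈ P κ X}) ↔ SStat κ X ζ y S) := fun S y hy =>
      SStat.congr fun z hz => ⟨fun h => h.1, fun h => ⟨h, hz.mem_P hy⟩⟩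
    obtain ⟨y, hyA, hy, h1, h2⟩ := H ζ hζ (S ∩ {z | z ∈ P κ X}) (T ∩ {z | z ∈ P κ X})
      Set.inter_subset_right Set.inter_subset_right ((key S x hx).2 hS) ((key T x hx).2 hT)
    rw [mem_P_kap] at hy
    exact ⟨y, hyA, hy, (key S y (hy.mem_P hx)).1 h1, (key T y (hy.mem_P hx)).1 h2⟩
  · simp only [mem_P_kap]
    exact H ζ hζ S T hS hT

theorem SStat.isSuccLimit {ξ : Ordinal.{u}} {x : ZFSet.{u}} {A : Set ZFSet.{u}}
    (h : SStat κ X ξ x A) : Order.IsSuccLimit (kap κ x) := by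
  rcases eq_or_ne ξ 0 with rfl | hξ
  · rw [sStat_zero_iff] at h
    by_contra hl
    obtain ⟨a, ha, ha'⟩ := exists_strongSubset_maximal h.1 hl
    obtain ⟨z, _, hz, haz⟩ := h.2 a ha
    exact ha' z haz hz
  · exact ((sStat_of_ne_zero hξ).1 h).1

theorem sStat_zero_above {x a : ZFSet.{u}} (hx : Order.IsSuccLimit (kap κ x))
    (ha : StrongSubset κ a x) : SStat κ X 0 x {z | StrongSubset κ a z} := by
  refine sStat_zero_iff.2 ⟨hx.ne_bot, fun y hy => ?_⟩
  obtain ⟨z, hz, haz, hyz⟩ := exists_strongSubset_above hx ha hy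
  exact ⟨z, haz, hz, hyz⟩

theorem SStat.zero_inter_above {x a : ZFSet.{u}} {A : Set ZFSet.{u}} (h : SStat κ X 0 x A)
    (ha : StrongSubset κ a x) : SStat κ X 0 x (A ∩ {z | StrongSubset κ a z}) := by
  refine sStat_zero_iff.2 ⟨h.isSuccLimit.ne_bot, fun y hy => ?_⟩
  obtain ⟨w, hw, haw, hyw⟩ := exists_strongSubset_above h.isSuccLimit ha hy
  obtain ⟨z, hz, hz', hwz⟩ := (sStat_zero_iff.1 h).2 w hw
  exact ⟨z, ⟨hz, haw.trans hwz⟩, hz', hyw.trans hwz⟩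

theorem strongSubset_of_sStat {x a : ZFSet.{u}} {A : Set ZFSet.{u}}
    (h : SStat κ X 0 x A) (ha : ∀ z ∈ A, StrongSubset κ a z) : StrongSubset κ a x := by
  obtain ⟨h1, h2⟩ := sStat_zero_iff.1 h
  obtain ⟨z, hz, hz', _⟩ := h2 ∅ (empty_strongSubset h1)
  exact (ha z hz).trans hz'

/-- Only `ζ = 0` needs an argument: the cone above `y` is 0-stationary, and any point reflecting it
lies above `y`. -/
theorem SStat.antitone {ξ ζ : Ordinal.{u}} (hζ : ζ ≤ ξ) {x : ZFSet.{u}} (hx : x ∈ P κ X)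
    {A : Set ZFSet.{u}} (h : SStat κ X ξ x A) : SStat κ X ζ x A := by
  rcases hζ.eq_or_lt with rfl | hlt
  · exact h
  have hξ : ξ ≠ 0 := by
    rintro rfl
    exact not_lt_bot hlt
  have hl := h.isSuccLimit
  rw [sStat_pos_iff hξ hx] at h
  rcases eq_or_ne ζ 0 with rfl | h0
  · refine sStat_zero_iff.2 ⟨hl.ne_bot, fun y hy => ?_⟩
    have hy' := sStat_zero_above (X := X) hl hy
    obtain ⟨z, hzA, hz, hz', _⟩ := h.2 0 hlt _ _ hy' hy'
    exact ⟨z, hzA, hz, strongSubset_of_sStat hz' fun w hw => hw⟩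
  · exact (sStat_pos_iff h0 hx).2 ⟨hl, fun η hη => h.2 η (hη.trans hlt)⟩

theorem SStat.exists_mem {ξ : Ordinal.{u}} {x : ZFSet.{u}} (hx : x ∈ P κ X) {A : Set ZFSet.{u}}
    (h : SStat κ X ξ x A) : ∃ z ∈ A, StrongSubset κ z x := by
  obtain ⟨h1, h2⟩ := sStat_zero_iff.1 (h.antitone (zero_le) hx)
  obtain ⟨z, hz, hz', _⟩ := h2 ∅ (empty_strongSubset h1)
  exact ⟨z, hz, hz'⟩

theorem sStat_limit {ξ : Ordinal.{u}} (hξ : Order.IsSuccLimit ξ) {x : ZFSet.{u}} (hx : x ∈ P κ X)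
    {A : Set ZFSet.{u}} (h : ∀ ζ < ξ, ζ ≠ 0 → SStat κ X ζ x A) : SStat κ X ξ x A := by
  have hs : ∀ ζ < ξ, SStat κ X (ζ + 1) x A := fun ζ hζ =>
    h _ (hξ.add_one_lt hζ) (Order.bot_lt_succ ζ).ne'
  refine (sStat_pos_iff hξ.ne_bot hx).2 ⟨(hs 0 hξ.bot_lt).isSuccLimit, fun ζ hζ => ?_⟩
  exact ((sStat_pos_iff (Order.bot_lt_succ ζ).ne' hx).1 (hs ζ hζ)).2 ζ (by simp)

/-- Limits of limit points are limit points: reflect first to a point `y` of the outer set, then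
from `y` into `A`. -/
theorem SStat.of_sStat {ξ ζ : Ordinal.{u}} (hζ : ζ ≤ ξ) {x : ZFSet.{u}} (hx : x ∈ P κ X)
    {A : Set ZFSet.{u}} (h : SStat κ X ξ x {y | SStat κ X ζ y A}) : SStat κ X ζ x A := by
  replace h := h.antitone hζ hx
  rcases eq_or_ne ζ 0 with rfl | h0
  · refine sStat_zero_iff.2 ⟨h.isSuccLimit.ne_bot, fun a ha => ?_⟩
    obtain ⟨y, hy, hyx, hay⟩ := (sStat_zero_iff.1 h).2 a ha
    obtain ⟨z, hz, hzy, haz⟩ := (sStat_zero_iff.1 hy).2 a hay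
    exact ⟨z, hz, hzy.trans hyx, haz⟩
  · refine (sStat_pos_iff h0 hx).2 ⟨h.isSuccLimit, fun η hη S T hS hT => ?_⟩
    obtain ⟨y, hy, hyx, hS', hT'⟩ := ((sStat_pos_iff h0 hx).1 h).2 η hη S T hS hT
    obtain ⟨z, hz, hzy, hS'', hT''⟩ :=
      ((sStat_pos_iff h0 (hyx.mem_P hx)).1 hy).2 η hη S T hS' hT'
    exact ⟨z, hz, hzy.trans hyx, hS'', hT''⟩

/-- Three sets `S`, `T`, `U` must reflect at one point of `A`, though the definition handles only
two sets of equal index. The sets of lower index are absorbed into those of higher index by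
induction, and recovered at the reflection point by `SStat.of_sStat`. -/
theorem SStat.inter {ξ ζ : Ordinal.{u}} (hζ : ζ < ξ) {x : ZFSet.{u}} (hx : x ∈ P κ X)
    {A S : Set ZFSet.{u}} (hA : SStat κ X ξ x A) (hS : SStat κ X ζ x S) :
    SStat κ X ξ x (A ∩ {y | SStat κ X ζ y S}) := by
  induction ξ using WellFoundedLT.induction generalizing ζ A S with
  | _ ξ ih =>
    have hξ : ξ ≠ 0 := by
      rintro rfl
      exact not_lt_bot hζ
    have hl := hA.isSuccLimit
    have hr := ((sStat_pos_iff hξ hx).1 hA).2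
    refine (sStat_pos_iff hξ hx).2 ⟨hl, fun η hη T U hT hU => ?_⟩
    rcases lt_trichotomy η ζ with h | rfl | h
    -- `S` has the larger index and absorbs both `T` and `U`.
    · have h1 := ih ζ hζ h (ih ζ hζ h hS hT) hU
      obtain ⟨y, hyA, hy, h2, -⟩ := hr ζ hζ _ _ h1 h1
      refine ⟨y, ⟨hyA, h2.mono fun z hz => hz.1.1⟩, hy, ?_, ?_⟩
      · exact SStat.of_sStat h.le (hy.mem_P hx) (h2.mono fun z hz => hz.1.2)
      · exact SStat.of_sStat h.le (hy.mem_P hx) (h2.mono fun z hz => hz.2)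
    -- With equal indices no set absorbs another. Instead the common reflection points of `T` and
    -- `U` form an η-stationary set, which is then reflected together with `S`.
    · have key : SStat κ X η x {y | SStat κ X η y T ∧ SStat κ X η y U} := by
        rcases eq_or_ne η 0 with rfl | h0
        · refine sStat_zero_iff.2 ⟨hl.ne_bot, fun a ha => ?_⟩
          obtain ⟨y, -, hy, hT', hU'⟩ := hr 0 hη _ _ (hT.zero_inter_above ha) hU
          exact ⟨y, ⟨hT'.mono Set.inter_subset_left, hU'⟩, hy, strongSubset_of_sStat hT' fun z hz => hz.2⟩
        · refine (sStat_pos_iff h0 hx).2 ⟨hl, fun ρ hρ V W hV hW => ?_⟩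
          obtain ⟨y, -, hy, hT', hU'⟩ := hr η hη _ _ (ih η hη hρ (ih η hη hρ hT hV) hW) hU
          refine ⟨y, ⟨hT'.mono fun z hz => hz.1.1, hU'⟩, hy, ?_, ?_⟩
          · exact SStat.of_sStat hρ.le (hy.mem_P hx) (hT'.mono fun z hz => hz.1.2)
          · exact SStat.of_sStat hρ.le (hy.mem_P hx) (hT'.mono fun z hz => hz.2)
      obtain ⟨y, hyA, hy, hS', h'⟩ := hr η hη _ _ hS key
      exact ⟨y, ⟨hyA, hS'⟩, hy, SStat.of_sStat le_rfl (hy.mem_P hx) (h'.mono fun z hz => hz.1),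
        SStat.of_sStat le_rfl (hy.mem_P hx) (h'.mono fun z hz => hz.2)⟩
    -- Here `T` has the larger index and absorbs `S`.
    · obtain ⟨y, hyA, hy, hT', hU'⟩ := hr η hη _ _ (ih η hη h hT hS) hU
      exact ⟨y, ⟨hyA, SStat.of_sStat h.le (hy.mem_P hx) (hT'.mono fun z hz => hz.2)⟩, hy,
        hT'.mono fun z hz => hz.1, hU'⟩

theorem SStat.inter_above {ξ : Ordinal.{u}} {x a : ZFSet.{u}} (hx : x ∈ P κ X)
    {A : Set ZFSet.{u}} (h : SStat κ X ξ x A) (ha : StrongSubset κ a x) :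
    SStat κ X ξ x (A ∩ {z | StrongSubset κ a z}) := by
  rcases eq_or_ne ξ 0 with rfl | hξ
  · exact h.zero_inter_above ha
  · refine (h.inter (pos_iff_ne_zero.2 hξ) hx (sStat_zero_above h.isSuccLimit ha)).mono ?_
    exact Set.inter_subset_inter_right _ fun z hz => strongSubset_of_sStat hz fun w hw => hw

end Stationary

/-! ### Limit points in the derived topologies -/

section Topology

open scoped Topology

variable {κ : Cardinal.{u}} {X : ZFSet.{u}}

theorem mem_subbase {ξ : Ordinal.{u}} {U : Set (Space κ X)} :
    U ∈ subbase κ X ξ ↔ U ∈ base₀ κ X ∨ ∃ ζ < ξ, ∃ A, U = cantor κ X ζ A := by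
  induction ξ using Ordinal.limitRecOn with
  | zero => simp [subbase_zero]
  | add_one ξ ih =>
    rw [subbase_add_one, Set.mem_union, ih, or_assoc]
    refine or_congr_right ⟨?_, ?_⟩
    · rintro (⟨ζ, hζ, A, rfl⟩ | ⟨A, rfl⟩)
      · exact ⟨ζ, hζ.trans (by simp), A, rfl⟩
      · exact ⟨ξ, by simp, A, rfl⟩
    · rintro ⟨ζ, hζ, A, rfl⟩
      rcases (Order.lt_add_one_iff.1 hζ).eq_or_lt with rfl | hζ
      · exact .inr ⟨A, rfl⟩
      · exact .inl ⟨ζ, hζ, A, rfl⟩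
  | limit ξ hξ ih =>
    rw [subbase_limit _ _ hξ]
    simp only [Set.mem_iUnion]
    constructor
    · rintro ⟨⟨ζ, hζ⟩, h⟩
      exact ((ih ζ hζ).1 h).imp_right fun ⟨η, hη, h⟩ => ⟨η, hη.trans hζ, h⟩
    · rintro (h | ⟨ζ, hζ, h⟩)
      · exact ⟨⟨0, hξ.bot_lt⟩, (ih 0 hξ.bot_lt).2 (.inl h)⟩
      · exact ⟨⟨ζ + 1, hξ.add_one_lt hζ⟩,
          (ih _ (hξ.add_one_lt hζ)).2 (.inr ⟨ζ, by simp, h⟩)⟩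

theorem isOpen_of_mem_base {ξ : Ordinal.{u}} {U : Set (Space κ X)} (h : U ∈ base₀ κ X) :
    IsOpen[tau κ X ξ] U :=
  TopologicalSpace.isOpen_generateFrom_of_mem (mem_subbase.2 (.inl h))

theorem isOpen_interval {ξ : Ordinal.{u}} {a x : Space κ X} (h : StrongSubset κ a.1 x.1) :
    IsOpen[tau κ X ξ] (interval κ X a x) :=
  isOpen_of_mem_base (.inr ⟨a, x, h, rfl⟩)

theorem isOpen_cantor {ξ ζ : Ordinal.{u}} (h : ζ < ξ) (A : Set (Space κ X)) :
    IsOpen[tau κ X ξ] (cantor κ X ζ A) :=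
  TopologicalSpace.isOpen_generateFrom_of_mem (mem_subbase.2 (.inr ⟨ζ, h, A, rfl⟩))

theorem mem_cantor {ξ : Ordinal.{u}} {x : Space κ X} {A : Set (Space κ X)} :
    x ∈ cantor κ X ξ A ↔ ∀ U, IsOpen[tau κ X ξ] U → x ∈ U → ∃ y ∈ U, y ∈ A ∧ y ≠ x := by
  let := tau κ X ξ
  rw [cantor, mem_derivedSet, accPt_iff_nhds]
  constructor
  · intro h U hU hx
    obtain ⟨y, hy, hne⟩ := h U (hU.mem_nhds hx)
    exact ⟨y, hy.1, hy.2, hne⟩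
  · intro h U hU
    obtain ⟨V, hV, hVo, hx⟩ := mem_nhds_iff.1 hU
    obtain ⟨y, hy, hyA, hne⟩ := h V hVo hx
    exact ⟨y, ⟨hV hy, hyA⟩, hne⟩

/-- If `κ_x` is a successor, some `a ≺ x` has nothing strictly between it and `x`, so `(a, x] =
{x}`. -/
theorem exists_isOpen_singleton {ξ : Ordinal.{u}} {x : Space κ X}
    (h : ¬ Order.IsSuccLimit (kap κ x.1)) : IsOpen[tau κ X ξ] {x} := by
  rcases eq_or_ne (kap κ x.1) 0 with h0 | h0
  · exact isOpen_of_mem_base (.inl ⟨x, h0, rfl⟩)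
  · obtain ⟨a, ha, ha'⟩ := exists_strongSubset_maximal h0 h
    have := isOpen_interval (ξ := ξ) (a := ⟨a, ha.mem_P x.2⟩) (x := x) ha
    convert this
    ext z
    constructor
    · rintro rfl
      exact .inr rfl
    · rintro (⟨h1, h2⟩ | rfl)
      · exact absurd h2 (ha' _ h1)
      · rfl

/-- Characterization of the derived topologies: the limit points of `A` in `τ_ξ` are the points
at which `A` is `ξ`-s-strongly stationary. -/
theorem mem_cantor_iff_sStat (ξ : Ordinal.{u}) (x : Space κ X) (A : Set (Space κ X)) :
    x ∈ cantor κ X ξ A ↔ SStat κ X ξ x.1 (Subtype.val '' A) := by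
  induction ξ using WellFoundedLT.induction generalizing x A with
  | _ ξ ih =>
    constructor
    · intro h
      rw [mem_cantor] at h
      have hl : Order.IsSuccLimit (kap κ x.1) := by
        by_contra hl
        obtain ⟨y, hy, _, hne⟩ := h _ (exists_isOpen_singleton hl) rfl
        exact hne hy
      rcases eq_or_ne ξ 0 with rfl | h0
      · refine sStat_zero_iff.2 ⟨hl.ne_bot, fun a ha => ?_⟩
        obtain ⟨y, hy, hyA, hne⟩ := h _ (isOpen_interval (a := ⟨a, ha.mem_P x.2⟩) ha) (.inr rfl)
        rcases hy with ⟨h1, h2⟩ | rfl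
        · exact ⟨y.1, ⟨y, hyA, rfl⟩, h2, h1⟩
        · exact absurd rfl hne
      · refine (sStat_pos_iff h0 x.2).2 ⟨hl, fun ζ hζ S T hS hT => ?_⟩
        have key : ∀ S : Set ZFSet.{u}, ∀ y : Space κ X,
            (y ∈ cantor κ X ζ (Subtype.val ⁻¹' S) ↔ SStat κ X ζ y.1 S) := fun S y => by
          rw [ih ζ hζ]
          refine SStat.congr fun z hz => ⟨?_, fun h => ⟨⟨z, hz.mem_P y.2⟩, h, rfl⟩⟩
          rintro ⟨w, hw, rfl⟩
          exact hw
        have he := empty_strongSubset hl.ne_bot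
        have hS' : IsOpen[tau κ X ξ] (cantor κ X ζ (Subtype.val ⁻¹' S)) := isOpen_cantor hζ _
        have hT' : IsOpen[tau κ X ξ] (cantor κ X ζ (Subtype.val ⁻¹' T)) := isOpen_cantor hζ _
        have hi : IsOpen[tau κ X ξ] (interval κ X ⟨∅, he.mem_P x.2⟩ x) := isOpen_interval he
        -- The two derived sets force `S` and `T` to be stationary at `y`; the interval, together
        -- with `y ≠ x`, forces `y ≺ x`.
        obtain ⟨y, hy, hyA, hne⟩ := h _
          ((tau κ X ξ).isOpen_inter _ _ ((tau κ X ξ).isOpen_inter _ _ hS' hT') hi)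
          ⟨⟨(key S x).2 hS, (key T x).2 hT⟩, .inr rfl⟩
        rcases hy.2 with ⟨-, h2⟩ | rfl
        · exact ⟨y.1, ⟨y, hyA, rfl⟩, h2, (key S y).1 hy.1.1, (key T y).1 hy.1.2⟩
        · exact absurd rfl hne
    · intro h
      -- Stationarity at `x` survives intersection with an open neighbourhood of `x`. Quantifying
      -- over `B` lets the members of a finite intersection be applied one after the other.
      have key : ∀ U, TopologicalSpace.GenerateOpen (subbase κ X ξ) U →
          ∀ B : Set ZFSet.{u}, x ∈ U → SStat κ X ξ x.1 B →
            SStat κ X ξ x.1 (B ∩ Subtype.val '' U) := by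
        intro U hU
        induction hU with
        | basic U hU =>
          intro B hx hB
          rcases mem_subbase.1 hU with (⟨y, hy, rfl⟩ | ⟨a, b, hab, rfl⟩) | ⟨ζ, hζ, C, rfl⟩
          · obtain rfl : x = y := hx
            exact absurd hy hB.isSuccLimit.ne_bot
          · have hax : StrongSubset κ a.1 x.1 := by
              rcases hx with h | rfl
              · exact h.1
              · exact hab
            refine (SStat.congr fun z hz => ?_).1 (hB.inter_above x.2 hax)
            refine and_congr_right fun _ => ⟨fun h => ?_, ?_⟩
            · refine ⟨⟨z, hz.mem_P x.2⟩, .inl ⟨h, ?_⟩, rfl⟩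
              rcases hx with h | rfl
              · exact hz.trans h.2
              · exact hz
            · rintro ⟨w, h | rfl, rfl⟩
              · exact h.1
              · exact hab
          · refine (SStat.congr fun z hz => ?_).1 (hB.inter hζ x.2 ((ih ζ hζ x C).1 hx))
            refine and_congr_right fun _ =>
              ⟨fun h => ⟨⟨z, hz.mem_P x.2⟩, (ih ζ hζ _ C).2 h, rfl⟩, ?_⟩
            rintro ⟨w, hw, rfl⟩
            exact (ih ζ hζ w C).1 hw
        | univ =>
          intro B _ hB
          refine (SStat.congr fun z hz => ?_).1 hB
          simp [hz.mem_P x.2]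
        | inter U V _ _ hU hV =>
          intro B hx hB
          refine (hV _ hx.2 (hU B hx.1 hB)).mono ?_
          rintro _ ⟨⟨hz, ⟨w, hw, rfl⟩⟩, ⟨w', hw', e⟩⟩
          obtain rfl := Subtype.ext e
          exact ⟨hz, ⟨w', ⟨hw, hw'⟩, rfl⟩⟩
        | sUnion S _ hS =>
          intro B hx hB
          obtain ⟨U, hU, hxU⟩ := hx
          exact (hS U hU B hxU hB).mono
            (Set.inter_subset_inter_right _ (Set.image_mono (Set.subset_sUnion_of_mem hU)))
      refine mem_cantor.2 fun U hU hx => ?_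
      obtain ⟨z, ⟨⟨y, hy, rfl⟩, ⟨y', hy', e⟩⟩, hz⟩ := (key U hU _ hx h).exists_mem x.2
      obtain rfl := Subtype.ext e
      exact ⟨y', hy', hy, fun e => hz.ne (congrArg Subtype.val e)⟩

theorem not_discreteTopology {ξ : Ordinal.{u}} {x : ZFSet.{u}} (hx : x ∈ P κ X)
    {A : Set ZFSet.{u}} (h : SStat κ X ξ x A) :
    ¬ @DiscreteTopology (Space κ X) (tau κ X ξ) := by
  intro hd
  have h1 : (⟨x, hx⟩ : Space κ X) ∈ cantor κ X ξ Set.univ := by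
    rw [mem_cantor_iff_sStat]
    have := h.inter_above hx (empty_strongSubset h.isSuccLimit.ne_bot)
    refine (SStat.congr (A := A ∩ {z | z ∈ P κ X}) fun z hz => ?_).2 h |>.mono ?_
    · simp [hz.mem_P hx]
    · rintro z ⟨_, hz⟩
      exact ⟨⟨z, hz⟩, trivial, rfl⟩
  obtain ⟨y, hy, -, hne⟩ := mem_cantor.1 h1 {⟨x, hx⟩} (@isOpen_discrete _ (tau κ X ξ) hd _) rfl
  exact hne hy

end Topology

/-! ### First-order notions evaluated in a structure -/

section Raw

variable (N : ZFSet.{u})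

/-- `b = {c, d}` as seen by `N`. -/
def CodesUnorderedPair (b c d : N) : Prop :=
  ∀ e : N, (e : ZFSet.{u}) ∈ (b : ZFSet.{u}) ↔ e = c ∨ e = d

/-- `p = (a, b)` as seen by `N`. -/
def CodesPair (p a b : N) : Prop :=
  ∃ s t : N, CodesUnorderedPair N p s t ∧ CodesUnorderedPair N s a a ∧ CodesUnorderedPair N t a b

/-- The relation coded by a set of pairs, as seen by `N`. -/
def Related (A : Set N) (a b : N) : Prop := ∃ p : N, p ∈ A ∧ CodesPair N p a b

/-- `Z` is the code of `0`. -/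
def CodesZero (Z : Set N) : Prop := ∃ a : N, a ∈ Z ∧ ∀ b : N, (b : ZFSet.{u}) ∉ (a : ZFSet.{u})

/-- `Z'` codes an ordinal below the one coded by `Z`. -/
def CodesBelow (Z' Z : Set N) : Prop :=
  ∃ a : N, a ∈ Z' ∧ (∀ b : N, b ∈ Z' → b = a) ∧ ∃ c : N, c ∈ Z ∧ (a : ZFSet.{u}) ∈ (c : ZFSet.{u})

/-- `Z'` codes an ordinal `β` in `O`, and `α ≤ β + 2` for the ordinal `α` coded by `Z`. -/
def CodesWithinTwo (O Z' Z : Set N) : Prop :=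
  ∃ b : N, b ∈ Z' ∧ (∀ b' : N, b' ∈ Z' → b' = b) ∧ b ∈ O ∧ ∃ a : N, a ∈ Z ∧
    ∀ c : N, (c : ZFSet.{u}) ∈ (a : ZFSet.{u}) → ∀ d : N, (d : ZFSet.{u}) ∈ (c : ZFSet.{u}) →
      (d : ZFSet.{u}) ∈ (b : ZFSet.{u}) ∨ d = b

/-- `Z'` equals `Z` or codes a nonzero ordinal below the one coded by `Z`. -/
def CodesUpTo (Z' Z : Set N) : Prop :=
  (∀ a : N, a ∈ Z' ↔ a ∈ Z) ∨ (CodesBelow N Z' Z ∧ ¬ CodesZero N Z')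

/-- `S` is stationary at `w`, with the index coded by `Z`, according to the predicates `O` (coding
`≺`) and `W` (coding stationarity). -/
def StatAt (O W Z S : Set N) (w : N) : Prop :=
  ∃ s : N, (∀ z : N, (z : ZFSet.{u}) ∈ (s : ZFSet.{u}) ↔ z ∈ S ∧ Related N O z w) ∧
    ∃ a : N, a ∈ Z ∧ ∃ p : N, p ∈ W ∧ ∃ q : N, CodesPair N p a q ∧ CodesPair N q w s

/-- `S` is cofinal, according to the predicates `D` and `O` (coding `≺`). -/
def CofinalIn (D O S : Set N) : Prop :=
  ∀ z : N, z ∈ D → ∃ w : N, w ∈ D ∧ w ∈ S ∧ Related N O z w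

/-- Some `w` in `D ∩ A` is a common reflection point of `S` and `T`. -/
def ReflectsIn (D O W A Z S T : Set N) : Prop :=
  ∃ w : N, w ∈ D ∧ w ∈ A ∧ StatAt N O W Z S w ∧ StatAt N O W Z T w

end Raw

theorem FO.codesUnorderedPair {n : ℕ} (i j k : Fin n) :
    FO.{u} n fun N _ v => CodesUnorderedPair N (v i) (v j) (v k) :=
  FO.all ((FO.mem _ _).iff ((FO.eq _ _).or (FO.eq _ _)))

theorem FO.codesPair {n : ℕ} (i j k : Fin n) :
    FO.{u} n fun N _ v => CodesPair N (v i) (v j) (v k) :=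
  FO.ex (FO.ex ((FO.codesUnorderedPair _ _ _).and
    ((FO.codesUnorderedPair _ _ _).and (FO.codesUnorderedPair _ _ _))))

theorem FO.related {n : ℕ} (m : ℕ) (i j : Fin n) :
    FO.{u} n fun N R v => Related N (R m) (v i) (v j) :=
  FO.ex ((FO.pred _ _).and (FO.codesPair _ _ _))

theorem FO.codesZero {n : ℕ} (m : ℕ) : FO.{u} n fun N R _ => CodesZero N (R m) :=
  FO.ex ((FO.pred _ _).and (FO.all (FO.mem _ _).neg))

theorem FO.codesBelow {n : ℕ} (m m' : ℕ) : FO.{u} n fun N R _ => CodesBelow N (R m) (R m') :=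
  FO.ex ((FO.pred _ _).and ((FO.all ((FO.pred _ _).imp (FO.eq _ _))).and
    (FO.ex ((FO.pred _ _).and (FO.mem _ _)))))

theorem FO.codesWithinTwo {n : ℕ} (k m m' : ℕ) :
    FO.{u} n fun N R _ => CodesWithinTwo N (R k) (R m) (R m') :=
  FO.ex ((FO.pred _ _).and ((FO.all ((FO.pred _ _).imp (FO.eq _ _))).and ((FO.pred _ _).and
    (FO.ex ((FO.pred _ _).and (FO.all ((FO.mem _ _).imp (FO.all ((FO.mem _ _).imp
      ((FO.mem _ _).or (FO.eq _ _)))))))))))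

theorem FO.codesUpTo {n : ℕ} (m m' : ℕ) : FO.{u} n fun N R _ => CodesUpTo N (R m) (R m') :=
  (FO.all ((FO.pred _ _).iff (FO.pred _ _))).or ((FO.codesBelow _ _).and (FO.codesZero _).neg)

theorem FO.statAt {n : ℕ} (k l m m' : ℕ) (i : Fin n) :
    FO.{u} n fun N R v => StatAt N (R k) (R l) (R m) (R m') (v i) :=
  FO.ex ((FO.all ((FO.mem _ _).iff ((FO.pred _ _).and (FO.related _ _ _)))).and
    (FO.ex ((FO.pred _ _).and (FO.ex ((FO.pred _ _).and
      (FO.ex ((FO.codesPair _ _ _).and (FO.codesPair _ _ _))))))))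

theorem FO.cofinalIn {n : ℕ} (k l m : ℕ) :
    FO.{u} n fun N R _ => CofinalIn N (R k) (R l) (R m) :=
  FO.all ((FO.pred _ _).imp (FO.ex ((FO.pred _ _).and ((FO.pred _ _).and (FO.related _ _ _)))))

theorem FO.reflectsIn {n : ℕ} (k l p m m' i j : ℕ) :
    FO.{u} n fun N R _ => ReflectsIn N (R k) (R l) (R p) (R m) (R m') (R i) (R j) :=
  FO.ex ((FO.pred _ _).and ((FO.pred _ _).and ((FO.statAt _ _ _ _ _).and (FO.statAt _ _ _ _ _))))

theorem PiPred.fo_and {F P : SOPred.{u}} {ξ : Ordinal.{u}} (hF : FO 0 fun N R _ => F N R)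
    (hP : P ∈ PiPred ξ) : (fun N R => F N R ∧ P N R) ∈ PiPred ξ := by
  have hff : FO.{u} 0 fun N R _ => F N R ∧ ¬ F N R := hF.and hF.neg
  refine PiPred.congr (PiPred.ite hF hP
    (PiPred.fo (P := fun N R => F N R ∧ ¬ F N R) hff ξ)) fun N R => ?_
  tauto

/-- The first-order guard supplies the nonemptiness that `PiPred.and` needs. -/
theorem PiPred.fo_and_and {F P Q : SOPred.{u}} {ξ : Ordinal.{u}} (hF : FO 0 fun N R _ => F N R)
    (hne : ∀ (N : ZFSet.{u}) (R : ℕ → Set N), F N R → Nonempty N)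
    (hP : P ∈ PiPred ξ) (hQ : Q ∈ PiPred ξ) :
    (fun N R => F N R ∧ P N R ∧ Q N R) ∈ PiPred ξ := by
  refine PiPred.congr (PiPred.fo_and hF (PiPred.and hP hQ)) fun N R => and_congr_right fun h => ?_
  simp only [hne N R h, true_imp_iff]

/-! ### Ordinals coded by second-order objects -/

/-- The singleton of `α`, as a subset of `N`. -/
def code (N : ZFSet.{u}) (α : Ordinal.{u}) : Set N := {a | (a : ZFSet.{u}) = α.toZFSet}

section Code

variable {N : ZFSet.{u}} {ν : Cardinal.{u}} (hN : cardSet ν ⊆ N)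

include hN

theorem toZFSet_mem {α : Ordinal.{u}} (hα : α < ν.ord) : α.toZFSet ∈ N :=
  hN (toZFSet_mem_cardSet.2 hα)

theorem codesZero_code {α : Ordinal.{u}} (hα : α < ν.ord) : CodesZero N (code N α) ↔ α = 0 := by
  constructor
  · rintro ⟨⟨a, ha⟩, rfl, h⟩
    by_contra h0
    have hpos : 0 < α := pos_iff_ne_zero.2 h0
    exact h ⟨_, toZFSet_mem hN (hpos.trans hα)⟩ (Ordinal.toZFSet_mem_toZFSet_iff.2 hpos)
  · rintro rfl
    exact ⟨⟨_, toZFSet_mem hN hα⟩, rfl, fun b => by simp⟩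

theorem codesBelow_code {α : Ordinal.{u}} (hα : α < ν.ord) {Z : Set N} :
    CodesBelow N Z (code N α) ↔ ∃ β < α, Z = code N β := by
  constructor
  · rintro ⟨a, ha, h, c, hc, hac⟩
    rw [show (c : ZFSet.{u}) = α.toZFSet from hc] at hac
    obtain ⟨β, hβ, e⟩ := Ordinal.mem_toZFSet_iff.1 hac
    refine ⟨β, hβ, ?_⟩
    ext b
    refine ⟨fun hb => (h b hb) ▸ e.symm, fun hb => ?_⟩
    have : b = a := Subtype.ext ((show (b : ZFSet.{u}) = β.toZFSet from hb).trans e)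
    exact this ▸ ha
  · rintro ⟨β, hβ, rfl⟩
    refine ⟨⟨_, toZFSet_mem hN (hβ.trans hα)⟩, rfl, fun b hb => Subtype.ext hb,
      ⟨_, toZFSet_mem hN hα⟩, rfl, Ordinal.toZFSet_mem_toZFSet_iff.2 hβ⟩

theorem codesUpTo_code {α : Ordinal.{u}} (hα : α < ν.ord) {Z : Set N} :
    CodesUpTo N Z (code N α) ↔ Z = code N α ∨ ∃ β < α, β ≠ 0 ∧ Z = code N β := by
  refine or_congr Set.ext_iff.symm ?_
  rw [codesBelow_code hN hα]
  constructor
  · rintro ⟨⟨β, hβ, rfl⟩, h⟩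
    exact ⟨β, hβ, fun h0 => h ((codesZero_code hN (hβ.trans hα)).2 h0), rfl⟩
  · rintro ⟨β, hβ, h0, rfl⟩
    exact ⟨⟨β, hβ, rfl⟩, fun h => h0 ((codesZero_code hN (hβ.trans hα)).1 h)⟩

theorem codesWithinTwo_code {α : Ordinal.{u}} (hα : α < ν.ord) {Z : Set N} :
    CodesWithinTwo N {a : N | (a : ZFSet.{u}) ∈ cardSet ν} Z (code N α) ↔
      ∃ β < ν.ord, Z = code N β ∧ α ≤ β + 2 := by
  -- The ordinal `β + 2` need not be formed inside the structure: the bound only concerns members of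
  -- members of `α`.
  have key : ∀ β : Ordinal.{u}, α ≤ β + 2 ↔ ∀ γ < α, ∀ δ < γ, δ ≤ β := by
    intro β
    have h2 : β + 2 = β + 1 + 1 := by rw [add_assoc, one_add_one_eq_two]
    rw [h2]
    constructor
    · intro h γ hγ δ hδ
      have h1 := Order.lt_add_one_iff.1 (hγ.trans_le h)
      exact Order.lt_add_one_iff.1 (hδ.trans_le h1)
    · intro h
      by_contra! h'
      have := h _ h' (β + 1) (by simp)
      simp at this
  constructor
  · rintro ⟨b, hb, hu, hO, a, ha, h⟩
    obtain ⟨β, hβ, e⟩ := Ordinal.mem_toZFSet_iff.1 (show (b : ZFSet.{u}) ∈ ν.ord.toZFSet from hO)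
    refine ⟨β, hβ, ?_, (key β).2 fun γ hγ δ hδ => ?_⟩
    · ext c
      refine ⟨fun hc => (hu c hc) ▸ e.symm, fun hc => ?_⟩
      have : c = b := Subtype.ext ((show (c : ZFSet.{u}) = β.toZFSet from hc).trans e)
      exact this ▸ hb
    · have ha' : (a : ZFSet.{u}) = α.toZFSet := ha
      have := h ⟨_, toZFSet_mem hN (hγ.trans hα)⟩
        (by rw [ha']; exact Ordinal.toZFSet_mem_toZFSet_iff.2 hγ)
        ⟨_, toZFSet_mem hN (hδ.trans (hγ.trans hα))⟩ (Ordinal.toZFSet_mem_toZFSet_iff.2 hδ)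
      rcases this with h1 | h1
      · rw [← e] at h1
        exact (Ordinal.toZFSet_mem_toZFSet_iff.1 h1).le
      · exact (Ordinal.toZFSet_injective ((congrArg Subtype.val h1).trans e.symm)).le
  · rintro ⟨β, hβ, rfl, h⟩
    refine ⟨⟨_, toZFSet_mem hN hβ⟩, rfl, fun b hb => Subtype.ext hb, toZFSet_mem_cardSet.2 hβ,
      ⟨_, toZFSet_mem hN hα⟩, rfl, fun c hc d hd => ?_⟩
    obtain ⟨γ, hγ, e⟩ := Ordinal.mem_toZFSet_iff.1 hc
    rw [← e] at hd
    obtain ⟨δ, hδ, e'⟩ := Ordinal.mem_toZFSet_iff.1 hd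
    rcases ((key β).1 h γ hγ δ hδ).eq_or_lt with rfl | hlt
    · exact .inr (Subtype.ext e'.symm)
    · left
      rw [← e']
      exact Ordinal.toZFSet_mem_toZFSet_iff.2 hlt

end Code

/-- Replacement of the sixth and seventh variable. -/
def subst {N : ZFSet.{u}} (R : ℕ → Set N) (Z S : Set N) (j : ℕ) : Set N :=
  if j = 5 then Z else if j = 6 then S else R j

theorem PiPred.subst {P : SOPred.{u}} {ξ : Ordinal.{u}} (h : P ∈ PiPred ξ) (k l : ℕ) :
    (fun N R => P N (TwoCardinal.subst (fun j => R (2 * j)) (R k) (R l))) ∈ PiPred ξ := by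
  refine PiPred.congr (PiPred.rename h fun j => if j = 5 then k else if j = 6 then l else 2 * j)
    fun N R => ?_
  have : (R ∘ fun j => if j = 5 then k else if j = 6 then l else 2 * j) =
      TwoCardinal.subst (fun j => R (2 * j)) (R k) (R l) := by
    funext j
    simp only [Function.comp, TwoCardinal.subst]
    split_ifs <;> rfl
  rw [this]

-- Defining comparison with a fixed ordinal

/-- The condition `α ≤ ζ` on the ordinal `α` coded by the variable `5` is `Π^1_{ζ+1}`, uniformly in
all structures whose ordinals form a cardinal. -/
def LeDefinable (ζ : Ordinal.{u}) : Prop :=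
  ∃ P ∈ PiPred.{u} (ζ + 1), ∀ (N : ZFSet.{u}) (ν : Cardinal.{u}), cardSet ν ⊆ N →
    ∀ R : ℕ → Set N, R 0 = {a : N | (a : ZFSet.{u}) ∈ cardSet ν} →
      ∀ α < ν.ord, R 5 = code N α → (P N R ↔ α ≤ ζ)

theorem leDefinable_zero : LeDefinable.{u} 0 := by
  refine ⟨fun N R => CodesZero N (R 5), PiPred.fo (FO.codesZero 5) _,
    fun N ν hN R _ α hα h5 => ?_⟩
  simp only [h5, codesZero_code hN hα]
  exact nonpos_iff_eq_zero.symm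

/-- `α ≤ ζ + 2` holds iff `α ≤ β + 2` for some `β ≤ ζ`. The existential quantifier, written as a
negated universal one, costs two levels, which is why the index advances by two. -/
theorem LeDefinable.add_two {ζ : Ordinal.{u}} (h : LeDefinable ζ) : LeDefinable (ζ + 1 + 1) := by
  obtain ⟨P, hP, hd⟩ := h
  -- Under interleaving the outer variable `j` becomes `2 * j` and the bound one `2 * j + 1`, so `1`
  -- stands for `Z 0` and `10` for the outer `5`.
  have hF : FO.{u} 0 fun N R _ => CodesWithinTwo N (R 0) (R 1) (R 10) := FO.codesWithinTwo 0 1 10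
  refine ⟨_, PiPred.not (PiPred.all
    (Q := fun N R Z => CodesWithinTwo N (R 0) (Z 0) (R 5) ∧ P N (subst R (Z 0) (Z 0)))
    (PiPred.fo_and (F := fun N R => CodesWithinTwo N (R 0) (R 1) (R 10)) hF
      (PiPred.subst hP 1 1))), fun N ν hN R h0 α hα h5 => ?_⟩
  have h2 : ζ + 1 + 1 = ζ + 2 := by rw [add_assoc, one_add_one_eq_two]
  simp only [not_forall, not_not, h5, h0, codesWithinTwo_code hN hα, h2]
  have hs : ∀ β < ν.ord, ∀ Z : Set N, Z = code N β → (P N (subst R Z Z) ↔ β ≤ ζ) :=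
    fun β hβ Z hZ => hd N ν hN _ (by simpa [subst] using h0) β hβ (by simpa [subst] using hZ)
  constructor
  · rintro ⟨Z, ⟨β, hβ, hZ, hle⟩, hPZ⟩
    exact hle.trans (add_le_add_left ((hs β hβ _ hZ).1 hPZ) 2)
  · intro hle
    have hm : min α ζ < ν.ord := (min_le_left _ _).trans_lt hα
    refine ⟨fun _ => code N (min α ζ), ⟨_, hm, rfl, ?_⟩, (hs _ hm _ rfl).2 (min_le_right _ _)⟩
    rcases le_total α ζ with h | h
    · rw [min_eq_left h]
      exact le_self_add
    · rwa [min_eq_right h]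

/-- `α ≤ ξ` holds iff no `β < α` satisfies `ξ ≤ β`, and `ξ ≤ β` is the conjunction of `¬ β ≤ η` over
cofinally many `η < ξ`. The conjunct for `η` has level `η + 2`, still below `ξ`; the other conjuncts
are filled with a tautology. -/
theorem leDefinable_limit {ξ : Ordinal.{u}} (hξ : Order.IsSuccLimit ξ)
    (h : ∀ ζ < ξ, LeDefinable ζ ∨ LeDefinable (ζ + 1)) : LeDefinable ξ := by
  classical
  choose P hP hd using fun (ζ : Ordinal.{u}) (h : LeDefinable ζ) => h
  have htt : FO.{u} 0 fun N R _ => ¬ (CodesZero N (R 0) ∧ ¬ CodesZero N (R 0)) :=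
    ((FO.codesZero 0).and (FO.codesZero 0).neg).neg
  let F : Ordinal.{u} → SOPred.{u} := fun ζ =>
    if h : ∃ η, ζ = η + 1 + 1 ∧ LeDefinable η then fun N R => ¬ P h.choose h.choose_spec.2 N R
    else fun N R => ¬ (CodesZero N (R 0) ∧ ¬ CodesZero N (R 0))
  have hF : ∀ ζ < ξ, F ζ ∈ PiPred ζ := by
    intro ζ _
    by_cases h : ∃ η, ζ = η + 1 + 1 ∧ LeDefinable η
    · simp only [F, h, dif_pos]
      have := PiPred.not (hP _ h.choose_spec.2)
      have e : PiPred ζ = PiPred (h.choose + 1 + 1) := congrArg _ h.choose_spec.1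
      rwa [e]
    · simp only [F, h, dif_neg, not_false_iff]
      exact PiPred.fo htt ζ
  have hG := PiPred.limit hξ hF 6
  have hB : FO.{u} 0 fun N R _ => CodesBelow N (R 1) (R 10) := FO.codesBelow 1 10
  refine ⟨_, PiPred.all (Q := fun N R Z => CodesBelow N (Z 0) (R 5) ∧
      ∀ ζ < ξ, F ζ N (subst R (Z 0) (Z 0) ∘ clip 6))
    (PiPred.fo_and (F := fun N R => CodesBelow N (R 1) (R 10)) hB (PiPred.subst hG 1 1)),
    fun N ν hN R h0 α hα h5 => ?_⟩
  have key : ∀ β < ν.ord, ∀ Z : Set N, Z = code N β →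
      ((∀ ζ < ξ, F ζ N (subst R Z Z ∘ clip 6)) ↔ ξ ≤ β) := by
    intro β hβ Z hZ
    have hs : ∀ η (h : LeDefinable η), P η h N (subst R Z Z ∘ clip 6) ↔ β ≤ η := fun η h =>
      hd η h N ν hN _ (by simpa [subst, clip] using h0) β hβ (by simpa [subst, clip] using hZ)
    constructor
    · intro H
      by_contra! hlt
      have : ∃ η, β ≤ η ∧ η < ξ ∧ LeDefinable η := by
        rcases h β hlt with h' | h'
        · exact ⟨β, le_rfl, hlt, h'⟩
        · exact ⟨β + 1, by simp, hξ.add_one_lt hlt, h'⟩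
      obtain ⟨η, hle, hη, hl⟩ := this
      have h2 := H (η + 1 + 1) (hξ.add_one_lt (hξ.add_one_lt hη))
      have hex : ∃ η', η + 1 + 1 = η' + 1 + 1 ∧ LeDefinable η' := ⟨η, rfl, hl⟩
      simp only [F, hex, dif_pos, hs] at h2
      have e : η = hex.choose := by
        have := hex.choose_spec.1
        rwa [Order.add_one_inj, Order.add_one_inj] at this
      exact h2 (e ▸ hle)
    · intro hle ζ hζ
      by_cases h : ∃ η, ζ = η + 1 + 1 ∧ LeDefinable η
      · simp only [F, h, dif_pos, hs, not_le]
        refine lt_of_lt_of_le ?_ hle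
        refine lt_of_le_of_lt ?_ hζ
        conv_rhs => rw [h.choose_spec.1]
        exact le_self_add.trans le_self_add
      · simp only [F, h, dif_neg, not_false_iff]
        tauto
  simp only [h5, codesBelow_code hN hα, not_and]
  constructor
  · intro H
    by_contra! hlt
    exact H (fun _ => code N ξ) ⟨ξ, hlt, rfl⟩ ((key ξ (hlt.trans hα) _ rfl).2 le_rfl)
  · rintro hle Z ⟨β, hβ, hZ⟩ H
    exact (((key β (hβ.trans hα) _ hZ).1 H).trans_lt hβ).not_ge hle

/-- Steps of two starting at zero and at limits reach every second ordinal, which is cofinal below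
each limit. -/
theorem leDefinable_or (ζ : Ordinal.{u}) : LeDefinable ζ ∨ LeDefinable (ζ + 1) := by
  induction ζ using Ordinal.limitRecOn with
  | zero => exact .inl leDefinable_zero
  | add_one ζ ih => exact ih.symm.imp_right LeDefinable.add_two
  | limit ζ hζ ih => exact .inl (leDefinable_limit hζ ih)

/-! ### Correctness of the coded notions in the levels `V_ν(ν, y)` -/

theorem card_unordered_pair_lt (a b : ZFSet.{u}) : ({a, b} : ZFSet.{u}).card < ℵ₀ := by
  refine ZFSet.card_insert_le.trans_lt ?_
  rw [ZFSet.card_singleton, one_add_one_eq_two]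
  exact natCast_lt_aleph0 (n := 2)

section Coding

variable {μ ν : Cardinal.{u}} {x y : ZFSet.{u}} (hc : Candidate μ x ν y) (hμ : ℵ₀ ≤ μ)

include hc

theorem codesUnorderedPair_iff {b c d : Vtop ν y} (hb : (b : ZFSet.{u}).card < μ) :
    CodesUnorderedPair (Vtop ν y) b c d ↔ (b : ZFSet.{u}) = {(c : ZFSet.{u}), (d : ZFSet.{u})} := by
  constructor
  · intro h
    ext e
    rw [ZFSet.mem_pair]
    constructor
    · intro he
      exact ((h ⟨e, (hc.small b.2 hb).2 he⟩).1 he).imp (congrArg Subtype.val) (congrArg Subtype.val)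
    · rintro (rfl | rfl)
      · exact (h c).2 (.inl rfl)
      · exact (h d).2 (.inr rfl)
  · intro h e
    rw [h, ZFSet.mem_pair]
    exact or_congr Subtype.ext_iff.symm Subtype.ext_iff.symm

include hμ

/-- A genuine pair and its two members are finite, hence below `μ` in size and fully visible in the
structure. The hypothesis excludes large sets, whose members may be partly missing from it. -/
theorem codesPair_iff {p a b : Vtop ν y} (hp : ∃ c d, (p : ZFSet.{u}) = ZFSet.pair c d) :
    CodesPair (Vtop ν y) p a b ↔ (p : ZFSet.{u}) = ZFSet.pair a b := by
  obtain ⟨c, d, hp⟩ := hp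
  have hps : (p : ZFSet.{u}).card < μ := by
    rw [hp]
    exact (card_unordered_pair_lt _ _).trans_le hμ
  have hs : ∀ s ∈ (p : ZFSet.{u}), s.card < μ := by
    intro s hs
    rw [hp] at hs
    refine lt_of_lt_of_le ?_ hμ
    rcases ZFSet.mem_pair.1 hs with rfl | rfl
    · rw [← ZFSet.pair_eq_singleton]
      exact card_unordered_pair_lt _ _
    · exact card_unordered_pair_lt _ _
  constructor
  · rintro ⟨s, t, h1, h2, h3⟩
    rw [codesUnorderedPair_iff hc (hs _ ((h1 s).2 (.inl rfl)))] at h2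
    rw [codesUnorderedPair_iff hc (hs _ ((h1 t).2 (.inr rfl)))] at h3
    rw [codesUnorderedPair_iff hc hps, h2, h3, ZFSet.pair_eq_singleton] at h1
    exact h1
  · intro h
    have hsm : ({(a : ZFSet.{u})} : ZFSet.{u}) ∈ (p : ZFSet.{u}) := by
      rw [h]
      exact ZFSet.mem_pair.2 (.inl rfl)
    have htm : ({(a : ZFSet.{u}), (b : ZFSet.{u})} : ZFSet.{u}) ∈ (p : ZFSet.{u}) := by
      rw [h]
      exact ZFSet.mem_pair.2 (.inr rfl)
    refine ⟨⟨_, (hc.small p.2 hps).2 hsm⟩, ⟨_, (hc.small p.2 hps).2 htm⟩, ?_, ?_, ?_⟩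
    · exact (codesUnorderedPair_iff hc hps).2 h
    · exact (codesUnorderedPair_iff hc (hs _ hsm)).2 (ZFSet.pair_eq_singleton _).symm
    · exact (codesUnorderedPair_iff hc (hs _ htm)).2 rfl

/-- This direction does not ask `ν` to be infinite, so it applies while nothing is yet known about
the size of `ν`. -/
theorem pair_mem_of_related {A : Set ZFSet.{u}} (hA : ∀ p ∈ A, ∃ c d, p = ZFSet.pair c d)
    {a b : Vtop ν y} (h : Related (Vtop ν y) {p | (p : ZFSet.{u}) ∈ A} a b) :
    ZFSet.pair a b ∈ A := by
  obtain ⟨p, hp, h⟩ := h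
  rw [codesPair_iff hc hμ (hA p hp)] at h
  exact h ▸ hp

theorem related_iff (hν : ℵ₀ ≤ ν) {A : Set ZFSet.{u}} (hA : ∀ p ∈ A, ∃ c d, p = ZFSet.pair c d)
    {a b : Vtop ν y} :
    Related (Vtop ν y) {p | (p : ZFSet.{u}) ∈ A} a b ↔ ZFSet.pair a b ∈ A := by
  refine ⟨pair_mem_of_related hc hμ hA, fun h => ?_⟩
  exact ⟨⟨_, pair_mem_Vtop hν a.2 b.2⟩, h, (codesPair_iff hc hμ ⟨_, _, rfl⟩).2 rfl⟩

end Coding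

-- Stationarity as seen by the reflected structures

/-- The situation in which stationarity is reflected: `x₀` is a point of `P_κ X` with
`x₀ ∩ κ = μ`, contained in the set `x` over which the hierarchy is built. -/
structure Setting (κ : Cardinal.{u}) (X : ZFSet.{u}) (μ : Cardinal.{u}) (x x₀ : ZFSet.{u}) :
    Prop where
  ordinals : ∀ a ∈ x, a.IsOrdinal
  subset : x₀ ⊆ x
  inter : x₀ ∩ cardSet κ = cardSet μ
  mem : x₀ ∈ P κ X
  aleph0_le : ℵ₀ ≤ μ

/-- The predicates over which stationarity is defined: the ordinals below `μ`, the elements of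
`P_μ x₀`, the relation `≺`, and the stationarity relation at points of `P_μ x₀`. -/
def basePred (κ : Cardinal.{u}) (X : ZFSet.{u}) (μ : Cardinal.{u}) (x₀ : ZFSet.{u}) :
    ℕ → Set ZFSet.{u}
  | 0 => {a | a ∈ cardSet μ}
  | 1 => {a | a ∈ P μ x₀}
  | 2 => {p | ∃ z w, z ∈ P μ x₀ ∧ w ∈ P μ x₀ ∧ StrongSubset κ z w ∧ p = ZFSet.pair z w}
  | 3 => {p | ∃ (α : Ordinal.{u}) (w s : ZFSet.{u}), s ⊆ P (kap κ w) w ∧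
      SStat κ X α w {z | z ∈ s} ∧ p = ZFSet.pair α.toZFSet (ZFSet.pair w s)}
  | _ => ∅

/-- The variables `0`, …, `3` have their intended values. -/
def IsBase (κ : Cardinal.{u}) (X : ZFSet.{u}) (μ : Cardinal.{u}) (x₀ N : ZFSet.{u})
    (R : ℕ → Set N) : Prop :=
  ∀ j < 4, R j = {a : N | (a : ZFSet.{u}) ∈ basePred κ X μ x₀ j}

theorem base_zero_eq {κ μ ν : Cardinal.{u}} {X x x₀ y : ZFSet.{u}} (hc : Candidate μ x ν y)
    {R : ℕ → Set (Vtop ν y)} (hR : IsBase κ X μ x₀ (Vtop ν y) R) :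
    R 0 = {a : Vtop ν y | (a : ZFSet.{u}) ∈ cardSet ν} := by
  rw [hR 0 (by norm_num)]
  ext a
  have := hc.mem_Vtop_and_mem_cardSet (a := a)
  simpa [basePred, a.2] using this

section Correctness

variable {κ μ ν : Cardinal.{u}} {X x x₀ y : ZFSet.{u}}

theorem Setting.cardSet_subset (hs : Setting κ X μ x x₀) : cardSet μ ⊆ x₀ := by
  rw [← hs.inter]
  exact fun a ha => (ZFSet.mem_inter.1 ha).1

theorem Setting.candidate_self (hs : Setting κ X μ x x₀) : Candidate μ x μ x :=
  ⟨hs.ordinals, fun _ h => h,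
    ZFSet.inter_eq_right_of_subset (hs.cardSet_subset.trans hs.subset)⟩

theorem Setting.mem_inter (hs : Setting κ X μ x x₀) (y : ZFSet.{u}) : y ∩ x₀ ∈ P κ X := by
  have h := mem_P.1 hs.mem
  have h' : y ∩ x₀ ⊆ x₀ := fun a ha => (ZFSet.mem_inter.1 ha).2
  exact mem_P.2 ⟨h'.trans h.1, (ZFSet.card_mono h').trans_lt h.2⟩

variable (hs : Setting κ X μ x x₀) (hc : Candidate μ x ν y)

include hs hc

theorem kap_inter_eq : kap κ (y ∩ x₀) = ν := by
  have : y ∩ x₀ ∩ cardSet κ = cardSet ν := by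
    rw [← hc.inter, ← hs.inter]
    ext a
    simp only [ZFSet.mem_inter]
    tauto
  rw [kap, this, card_cardSet]

theorem strongSubset_inter_iff {z : ZFSet.{u}} :
    StrongSubset κ z (y ∩ x₀) ↔ z ∈ Vtop ν y ∧ z ∈ P μ x₀ := by
  rw [hc.mem_Vtop_and_mem_P hs.subset, ← mem_P_kap, kap_inter_eq hs hc]

theorem related_strongSubset_iff (hν : ℵ₀ ≤ ν) {z w : Vtop ν y} (hw : (w : ZFSet.{u}) ∈ P μ x₀) :
    Related (Vtop ν y) {a | (a : ZFSet.{u}) ∈ basePred κ X μ x₀ 2} z w ↔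
      StrongSubset κ (z : ZFSet.{u}) w := by
  rw [related_iff hc hs.aleph0_le hν]
  · constructor
    · rintro ⟨z', w', -, -, h, e⟩
      obtain ⟨rfl, rfl⟩ := ZFSet.pair_inj.1 e
      exact h
    · intro h
      have hw' := (strongSubset_inter_iff hs hc).2 ⟨w.2, hw⟩
      exact ⟨_, _, ((strongSubset_inter_iff hs hc).1 (h.trans hw')).2, hw, h, rfl⟩
  · rintro p ⟨z, w, -, -, -, h⟩
    exact ⟨z, w, h⟩

variable {R : ℕ → Set (Vtop ν y)} (hR : IsBase κ X μ x₀ (Vtop ν y) R)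

include hR

theorem cofinalIn_iff (hν : ℵ₀ ≤ ν) {S : Set (Vtop ν y)} :
    CofinalIn (Vtop ν y) (R 1) (R 2) S ↔ SStat κ X 0 (y ∩ x₀) (Subtype.val '' S) := by
  rw [sStat_zero_iff, kap_inter_eq hs hc, hR 1 (by norm_num), hR 2 (by norm_num)]
  have h0 : ν ≠ 0 := (aleph0_pos.trans_le hν).ne'
  simp only [h0, ne_eq, not_false_eq_true, true_and]
  constructor
  · intro H z hz
    have hz' := (strongSubset_inter_iff hs hc).1 hz
    obtain ⟨w, hw, hwS, h⟩ := H ⟨z, hz'.1⟩ hz'.2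
    exact ⟨w, ⟨w, hwS, rfl⟩, (strongSubset_inter_iff hs hc).2 ⟨w.2, hw⟩,
      (related_strongSubset_iff hs hc hν hw).1 h⟩
  · intro H z hz
    obtain ⟨_, ⟨w, hwS, rfl⟩, hw, h⟩ := H z ((strongSubset_inter_iff hs hc).2 ⟨z.2, hz⟩)
    have hw' := ((strongSubset_inter_iff hs hc).1 hw).2
    exact ⟨w, hw', hwS, (related_strongSubset_iff hs hc hν hw').2 h⟩

/-- Stationarity at `w` depends only on the part of `S` below `w`, a family of at most `2 ^ |w| < ν`
sets. Since `ν` is a strong limit this family is an element of the structure, so stationarity is a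
first-order lookup in predicate `3`. -/
theorem statAt_iff (hν : ν.IsStrongLimit) {α : Ordinal.{u}} (hα : α < ν.ord)
    {S : Set (Vtop ν y)} {w : Vtop ν y} (hw : (w : ZFSet.{u}) ∈ P μ x₀) :
    StatAt (Vtop ν y) (R 2) (R 3) (code (Vtop ν y) α) S w ↔
      SStat κ X α w (Subtype.val '' S) := by
  have hinf := hν.aleph0_le
  have hwy := (strongSubset_inter_iff hs hc).2 ⟨w.2, hw⟩
  have hPw : ∀ {z : ZFSet.{u}}, z ∈ P (kap κ w) w → z ∈ Vtop ν y := fun hz =>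
    ((strongSubset_inter_iff hs hc).1 ((mem_P_kap.1 hz).trans hwy)).1
  rw [hR 2 (by norm_num), hR 3 (by norm_num)]
  constructor
  · rintro ⟨s, hsS, a, ha, p, ⟨β, w', s', hs', hstat, e⟩, q, hp, hq⟩
    rw [codesPair_iff hc hs.aleph0_le ⟨_, _, e⟩, e] at hp
    obtain ⟨h1, h2⟩ := ZFSet.pair_inj.1 hp
    rw [codesPair_iff hc hs.aleph0_le ⟨_, _, h2.symm⟩, ← h2] at hq
    obtain ⟨rfl, rfl⟩ := ZFSet.pair_inj.1 hq
    obtain rfl : β = α := Ordinal.toZFSet_injective (h1.trans ha)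
    refine (SStat.congr fun z hz => ?_).1 hstat
    have hzN := hPw (mem_P_kap.2 hz)
    have := hsS ⟨z, hzN⟩
    rw [related_strongSubset_iff hs hc hinf hw] at this
    simpa [hz, hzN] using this
  · intro hstat
    have hsub : (P (kap κ w) w).sep (fun z => z ∈ Subtype.val '' S) ⊆ P (kap κ w) w :=
      ZFSet.sep_subset
    have hlt : (w : ZFSet.{u}).card < ν := by
      have := hwy.2
      rwa [kap_inter_eq hs hc] at this
    have hsN : (P (kap κ w) w).sep (fun z => z ∈ Subtype.val '' S) ∈ Vtop ν y := by
      refine mem_Vtop_of_subset_P hinf (fun z hz => ?_) ?_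
      · have hz' := (mem_P_kap.1 (hsub hz)).trans hwy
        rw [strongSubset_inter_iff hs hc, hc.mem_Vtop_and_mem_P hs.subset] at hz'
        exact P_mono le_rfl (fun b hb => (ZFSet.mem_inter.1 hb).1) hz'
      · refine lt_of_le_of_lt ?_ (hν.isStrongPrelimit hlt)
        rw [← ZFSet.card_powerset]
        exact ZFSet.card_mono fun z hz => ZFSet.mem_powerset.2 (mem_P.1 (hsub hz)).1
    have hαN : α.toZFSet ∈ Vtop ν y :=
      toZFSet_mem (hc.cardSet_subset.trans (subset_Vtop ν y)) hα
    have hq := pair_mem_Vtop hinf w.2 hsN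
    refine ⟨⟨_, hsN⟩, fun z => ?_, ⟨_, hαN⟩, rfl, ⟨_, pair_mem_Vtop hinf hαN hq⟩,
      ⟨α, w, _, hsub, ?_, rfl⟩, ⟨_, hq⟩, ?_, ?_⟩
    · rw [related_strongSubset_iff hs hc hinf hw, ZFSet.mem_sep, mem_P_kap]
      simp [and_comm]
    · refine (SStat.congr fun z hz => ?_).1 hstat
      simp only [Set.mem_ofPred_eq, ZFSet.mem_sep, mem_P_kap, hz, true_and]
    · exact (codesPair_iff hc hs.aleph0_le ⟨_, _, rfl⟩).2 rfl
    · exact (codesPair_iff hc hs.aleph0_le ⟨_, _, rfl⟩).2 rfl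

theorem reflectsIn_iff (hν : ν.IsStrongLimit) {α : Ordinal.{u}} (hα : α < ν.ord)
    {A S T : Set (Vtop ν y)} :
    ReflectsIn (Vtop ν y) (R 1) (R 2) (R 3) A (code (Vtop ν y) α) S T ↔
      ∃ w ∈ Subtype.val '' A, StrongSubset κ w (y ∩ x₀) ∧
        SStat κ X α w (Subtype.val '' S) ∧ SStat κ X α w (Subtype.val '' T) := by
  have h1 : R 1 = {a : Vtop ν y | (a : ZFSet.{u}) ∈ P μ x₀} := hR 1 (by norm_num)
  constructor
  · rintro ⟨w, hw, hwA, hS, hT⟩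
    rw [h1] at hw
    exact ⟨w, ⟨w, hwA, rfl⟩, (strongSubset_inter_iff hs hc).2 ⟨w.2, hw⟩,
      (statAt_iff hs hc hR hν hα hw).1 hS, (statAt_iff hs hc hR hν hα hw).1 hT⟩
  · rintro ⟨_, ⟨w, hwA, rfl⟩, hw, hS, hT⟩
    have hw' := ((strongSubset_inter_iff hs hc).1 hw).2
    refine ⟨w, by rw [h1]; exact hw', hwA, ?_, ?_⟩
    · exact (statAt_iff hs hc hR hν hα hw').2 hS
    · exact (statAt_iff hs hc hR hν hα hw').2 hT

end Correctness

-- Defining stationarity at the top point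

/-- Stationarity of the variable `6` at the index coded by the variable `5` is `Π^1_ζ` for indices up
to `ζ`. -/
def StatDefinable (κ : Cardinal.{u}) (X : ZFSet.{u}) (μ : Cardinal.{u}) (x x₀ : ZFSet.{u})
    (ζ : Ordinal.{u}) : Prop :=
  ∃ P ∈ PiPred.{u} ζ, ∀ (ν : Cardinal.{u}) (y : ZFSet.{u}), Candidate μ x ν y → ν.IsStrongLimit →
    ∀ R : ℕ → Set (Vtop ν y), IsBase κ X μ x₀ (Vtop ν y) R →
      ∀ α < ν.ord, α ≤ ζ → R 5 = code (Vtop ν y) α →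
        (P (Vtop ν y) R ↔ SStat κ X α (y ∩ x₀) (Subtype.val '' R 6))

theorem IsBase.congr {κ μ : Cardinal.{u}} {X x₀ N : ZFSet.{u}} {R R' : ℕ → Set N}
    (h : IsBase κ X μ x₀ N R) (e : ∀ j < 4, R' j = R j) : IsBase κ X μ x₀ N R' :=
  fun j hj => (e j hj).trans (h j hj)

theorem IsBase.subst {κ μ : Cardinal.{u}} {X x₀ N : ZFSet.{u}} {R : ℕ → Set N}
    (h : IsBase κ X μ x₀ N R) (Z S : Set N) : IsBase κ X μ x₀ N (subst R Z S) :=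
  h.congr fun j hj => by
    have h5 : j ≠ 5 := by omega
    have h6 : j ≠ 6 := by omega
    simp [TwoCardinal.subst, h5, h6]

/-- The conjuncts of the limit step. For `ζ = η + 2`, a formula of level `η` is correct only at
indices up to `η`, so the universally quantified `β` is guarded by `β ≤ η`. This guard and the
negated stationarity formula both have level `η + 1`. For other `ζ` the conjunct is a tautology. -/
theorem exists_piPred_stat_upTo {κ μ : Cardinal.{u}} {X x x₀ : ZFSet.{u}} {ζ : Ordinal.{u}}
    (h : ∀ η, η < ζ → StatDefinable κ X μ x x₀ η) :
    ∃ Q ∈ PiPred.{u} ζ, ∀ (ν : Cardinal.{u}) (y : ZFSet.{u}), Candidate μ x ν y →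
      ν.IsStrongLimit → ∀ R : ℕ → Set (Vtop ν y), IsBase κ X μ x₀ (Vtop ν y) R →
        ∀ α < ν.ord, R 5 = code (Vtop ν y) α →
          (Q (Vtop ν y) R ↔ ∀ η, ζ = η + 1 + 1 → LeDefinable η →
            ∀ β, (β = α ∨ (β < α ∧ β ≠ 0)) → β ≤ η →
              SStat κ X β (y ∩ x₀) (Subtype.val '' R 6)) := by
  by_cases hη : ∃ η, ζ = η + 1 + 1 ∧ LeDefinable η
  · obtain ⟨η, rfl, L, hL, hLd⟩ := hη
    obtain ⟨P, hP, hd⟩ := h η ((lt_add_one η).trans (lt_add_one _))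
    have hG : FO.{u} 0 fun N R _ => (∃ a : N, a ∈ R 1) ∧ CodesUpTo N (R 1) (R 10) :=
      (FO.ex (FO.pred 1 _)).and (FO.codesUpTo 1 10)
    refine ⟨_, PiPred.all (Q := fun N R Z => ((∃ a : N, a ∈ Z 0) ∧ CodesUpTo N (Z 0) (R 5)) ∧
        L N (subst R (Z 0) (R 6)) ∧ ¬ P N (subst R (Z 0) (R 6)))
      (PiPred.fo_and_and (F := fun N R => (∃ a : N, a ∈ R 1) ∧ CodesUpTo N (R 1) (R 10)) hG
        (fun N R h => ⟨h.1.choose⟩) (PiPred.subst hL 1 12)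
        (PiPred.subst (PiPred.not hP) 1 12)), fun ν y hc hν R hR α hα h5 => ?_⟩
    have hN : cardSet ν ⊆ Vtop ν y := hc.cardSet_subset.trans (subset_Vtop ν y)
    rw [h5]
    simp only [codesUpTo_code hN hα]
    have hLs : ∀ β < ν.ord, ∀ Z S : Set (Vtop ν y), Z = code (Vtop ν y) β →
        (L (Vtop ν y) (subst R Z S) ↔ β ≤ η) := fun β hβ Z S hZ =>
      hLd _ ν hN _ (base_zero_eq hc (hR.subst Z S)) β hβ (by simpa [subst] using hZ)
    have hPs : ∀ β < ν.ord, β ≤ η → ∀ Z S : Set (Vtop ν y), Z = code (Vtop ν y) β →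
        (P (Vtop ν y) (subst R Z S) ↔ SStat κ X β (y ∩ x₀) (Subtype.val '' S)) := by
      intro β hβ hle Z S hZ
      have := hd ν y hc hν (subst R Z S) (hR.subst Z S) β hβ hle (by simpa [subst] using hZ)
      simpa [subst] using this
    constructor
    · intro H η' e _ β hβ hle
      obtain rfl : η = η' := by rwa [Order.add_one_inj, Order.add_one_inj] at e
      have hβν : β < ν.ord := by
        rcases hβ with rfl | hβ
        · exact hα
        · exact hβ.1.trans hα
      by_contra hcon
      refine H (fun _ => code (Vtop ν y) β) ⟨⟨⟨⟨_, toZFSet_mem hN hβν⟩, rfl⟩, ?_⟩,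
        (hLs β hβν _ _ rfl).2 hle, fun hp => hcon ((hPs β hβν hle _ _ rfl).1 hp)⟩
      rcases hβ with rfl | hβ
      · exact .inl rfl
      · exact .inr ⟨β, hβ.1, hβ.2, rfl⟩
    · rintro H Z ⟨⟨-, hZ⟩, hLZ, hPZ⟩
      have hZ' : ∃ β < ν.ord, (β = α ∨ (β < α ∧ β ≠ 0)) ∧ Z 0 = code (Vtop ν y) β := by
        rcases hZ with hZ | ⟨β, hβ, h0, hZ⟩
        · exact ⟨α, hα, .inl rfl, hZ⟩
        · exact ⟨β, hβ.trans hα, .inr ⟨hβ, h0⟩, hZ⟩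
      obtain ⟨β, hβ, hβα, hZ⟩ := hZ'
      have hle := (hLs β hβ _ _ hZ).1 hLZ
      exact hPZ ((hPs β hβ hle _ _ hZ).2 (H η rfl ⟨L, hL, hLd⟩ β hβα hle))
  · have htt : FO.{u} 0 fun N R _ => CodesZero N (R 0) → CodesZero N (R 0) :=
      (FO.codesZero 0).imp (FO.codesZero 0)
    refine ⟨_, PiPred.fo (P := fun N R => CodesZero N (R 0) → CodesZero N (R 0)) htt ζ,
      fun ν y hc hν R hR α hα h5 => ?_⟩
    exact ⟨fun _ η e hl => absurd ⟨η, e, hl⟩ hη, fun _ => id⟩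

section Definability

variable {κ μ : Cardinal.{u}} {X x x₀ : ZFSet.{u}} (hs : Setting κ X μ x x₀)

include hs

theorem statDefinable_zero : StatDefinable κ X μ x x₀ 0 := by
  refine ⟨fun N R => CofinalIn N (R 1) (R 2) (R 6), PiPred.fo (FO.cofinalIn 1 2 6) 0,
    fun ν y hc hν R hR α _ hα0 _ => ?_⟩
  obtain rfl : α = 0 := nonpos_iff_eq_zero.1 hα0
  exact cofinalIn_iff hs hc hR hν.aleph0_le

/-- One universal block over `(β, S, T)` excludes a counterexample: `β < α`, both sets β-stationary,
and no common reflection point. The last condition is first-order, and `β ≤ ζ` makes the formula of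
level `ζ` applicable. Index `0` is treated separately by a first-order clause. -/
theorem StatDefinable.add_one {ζ : Ordinal.{u}} (h : StatDefinable κ X μ x x₀ ζ) :
    StatDefinable κ X μ x x₀ (ζ + 1) := by
  obtain ⟨P, hP, hd⟩ := h
  have hF : FO.{u} 0 fun N R _ => CodesZero N (R 5) → CofinalIn N (R 1) (R 2) (R 6) :=
    (FO.codesZero 5).imp (FO.cofinalIn 1 2 6)
  have hG : FO.{u} 0 fun N R _ => CodesBelow N (R 1) (R 10) ∧
      ¬ ReflectsIn N (R 2) (R 4) (R 6) (R 12) (R 1) (R 3) (R 5) :=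
    (FO.codesBelow 1 10).and (FO.reflectsIn 2 4 6 12 1 3 5).neg
  have hne : ∀ (N : ZFSet.{u}) (R : ℕ → Set N), (CodesBelow N (R 1) (R 10) ∧
      ¬ ReflectsIn N (R 2) (R 4) (R 6) (R 12) (R 1) (R 3) (R 5)) → Nonempty N :=
    fun N R h => ⟨h.1.choose⟩
  refine ⟨_, PiPred.fo_and (F := fun N R => CodesZero N (R 5) → CofinalIn N (R 1) (R 2) (R 6)) hF
    (PiPred.all (Q := fun N R Z => (CodesBelow N (Z 0) (R 5) ∧
        ¬ ReflectsIn N (R 1) (R 2) (R 3) (R 6) (Z 0) (Z 1) (Z 2)) ∧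
        P N (subst R (Z 0) (Z 1)) ∧ P N (subst R (Z 0) (Z 2)))
      (PiPred.fo_and_and (F := fun N R => CodesBelow N (R 1) (R 10) ∧
        ¬ ReflectsIn N (R 2) (R 4) (R 6) (R 12) (R 1) (R 3) (R 5)) hG hne
        (PiPred.subst hP 1 3) (PiPred.subst hP 1 5))), fun ν y hc hν R hR α hα hαζ h5 => ?_⟩
  have hN : cardSet ν ⊆ Vtop ν y := hc.cardSet_subset.trans (subset_Vtop ν y)
  rw [h5, codesZero_code hN hα, cofinalIn_iff hs hc hR hν.aleph0_le]
  have key : ∀ β < α, ∀ Z S : Set (Vtop ν y), Z = code (Vtop ν y) β →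
      (P (Vtop ν y) (subst R Z S) ↔ SStat κ X β (y ∩ x₀) (Subtype.val '' S)) := by
    intro β hβ Z S hZ
    have := hd ν y hc hν (subst R Z S) (hR.subst Z S) β (hβ.trans hα)
      (Order.lt_add_one_iff.1 (hβ.trans_le hαζ)) (by simpa [subst] using hZ)
    simpa [subst] using this
  rcases eq_or_ne α 0 with rfl | h0
  · refine ⟨fun h => h.1 rfl, fun h => ⟨fun _ => h, fun Z hZ => ?_⟩⟩
    obtain ⟨β, hβ, -⟩ := (codesBelow_code hN hα).1 hZ.1.1
    exact not_lt_bot hβ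
  · rw [sStat_pos_iff h0 (hs.mem_inter y), kap_inter_eq hs hc]
    -- The limit-cardinal clause is automatic since `ν` is a strong limit; the formula does not
    -- express it.
    simp only [h0, false_imp_iff, true_and, hν.isSuccLimit, codesBelow_code hN hα]
    constructor
    · intro H β hβ S T hS hT
      -- Second-order variables range only over subsets of the structure. Stationarity at these
      -- points does not notice the restriction, as all sets strictly below them are elements of the
      -- structure.
      have hcut : ∀ (U : Set ZFSet.{u}) (w : ZFSet.{u}), w = y ∩ x₀ ∨ StrongSubset κ w (y ∩ x₀) →
          (SStat κ X β w (Subtype.val '' {a : Vtop ν y | (a : ZFSet.{u}) ∈ U}) ↔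
            SStat κ X β w U) := by
        intro U w hw
        refine SStat.congr fun z hz => ⟨?_, fun h => ⟨⟨z, ?_⟩, h, rfl⟩⟩
        · rintro ⟨a, ha, rfl⟩
          exact ha
        · have hz' : StrongSubset κ z (y ∩ x₀) := by
            rcases hw with rfl | hw
            · exact hz
            · exact hz.trans hw
          exact ((strongSubset_inter_iff hs hc).1 hz').1
      have := H fun j => if j = 0 then code _ β else if j = 1 then {a | (a : ZFSet.{u}) ∈ S}
        else {a | (a : ZFSet.{u}) ∈ T}
      simp only [if_true, one_ne_zero, if_false, OfNat.ofNat_ne_zero, OfNat.ofNat_ne_one] at this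
      rw [key β hβ _ _ rfl, key β hβ _ _ rfl, hcut S _ (.inl rfl), hcut T _ (.inl rfl),
        reflectsIn_iff hs hc hR hν (hβ.trans hα)] at this
      by_contra hcon
      refine this ⟨⟨⟨β, hβ, rfl⟩, ?_⟩, hS, hT⟩
      rintro ⟨w, hwA, hw, h1, h2⟩
      exact hcon ⟨w, hwA, hw, (hcut S w (.inr hw)).1 h1, (hcut T w (.inr hw)).1 h2⟩
    · rintro H Z ⟨⟨⟨β, hβ, hZ⟩, hr⟩, hS, hT⟩
      rw [key β hβ _ _ hZ] at hS hT
      rw [hZ, reflectsIn_iff hs hc hR hν (hβ.trans hα)] at hr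
      exact hr (H β hβ _ _ hS hT)

/-- For `α = ξ`, stationarity means stationarity at all nonzero `β < ξ`; for `α < ξ` the instance `β
= α` suffices. Each relevant `β` is below some definable `η < ξ` and is handled by conjunct `η + 2`.
-/
theorem statDefinable_limit {ξ : Ordinal.{u}} (hξ : Order.IsSuccLimit ξ)
    (h : ∀ ζ < ξ, StatDefinable κ X μ x x₀ ζ) : StatDefinable κ X μ x x₀ ξ := by
  have hF := fun ζ (hζ : ζ < ξ) => exists_piPred_stat_upTo fun η hη => h η (hη.trans hζ)
  choose! Q hQ hd using hF
  refine ⟨_, PiPred.limit hξ hQ 7, fun ν y hc hν R hR α hα hαξ h5 => ?_⟩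
  have hclip : ∀ j < 7, (R ∘ clip 7) j = R j := by
    intro j hj
    simp [clip, hj]
  have hQs : ∀ ζ < ξ, (Q ζ (Vtop ν y) (R ∘ clip 7) ↔ _) := fun ζ hζ =>
    hd ζ hζ ν y hc hν (R ∘ clip 7) (hR.congr fun j hj => hclip j (by omega)) α hα
      ((hclip 5 (by norm_num)).trans h5)
  rw [hclip 6 (by norm_num)] at hQs
  constructor
  · intro H
    have main : ∀ β < ξ, (β = α ∨ (β < α ∧ β ≠ 0)) →
        SStat κ X β (y ∩ x₀) (Subtype.val '' R 6) := by
      intro β hβξ hβ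
      obtain ⟨η, hle, hη, hl⟩ : ∃ η, β ≤ η ∧ η < ξ ∧ LeDefinable η := by
        rcases leDefinable_or β with h' | h'
        · exact ⟨β, le_rfl, hβξ, h'⟩
        · exact ⟨β + 1, by simp, hξ.add_one_lt hβξ, h'⟩
      have hlt := hξ.add_one_lt (hξ.add_one_lt hη)
      exact (hQs _ hlt).1 (H _ hlt) η rfl hl β hβ hle
    rcases hαξ.eq_or_lt with rfl | hlt
    · exact sStat_limit hξ (hs.mem_inter y) fun β hβ h0 => main β hβ (.inr ⟨hβ, h0⟩)
    · exact main α hlt (.inl rfl)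
  · intro H ζ hζ
    rw [hQs ζ hζ]
    rintro η - - β (rfl | ⟨hβ, -⟩) -
    · exact H
    · exact H.antitone hβ.le (hs.mem_inter y)

theorem statDefinable (ζ : Ordinal.{u}) : StatDefinable κ X μ x x₀ ζ := by
  induction ζ using Ordinal.limitRecOn with
  | zero => exact statDefinable_zero hs
  | add_one ζ ih => exact ih.add_one hs
  | limit ζ hζ ih => exact statDefinable_limit hs hζ ih

end Definability

/-! ### Consequences of indescribability -/

section Indescribability

variable {μ : Cardinal.{u}} {x : ZFSet.{u}} {ξ : Ordinal.{u}} {A : Set ZFSet.{u}}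

theorem Indescribable.reflects (h : Indescribable μ x ξ A) {Q : SOPred.{u}} (hQ : Q ∈ PiPred ξ)
    (B : ℕ → Set ZFSet.{u}) (hB : Q (Vtop μ x) fun j => {a | (a : ZFSet.{u}) ∈ B j}) :
    ∃ y ∈ A, y ∈ P μ x ∧ y ∩ cardSet μ = cardSet (kap μ y) ∧
      Q (Vtop (kap μ y) y) fun j => {a | (a : ZFSet.{u}) ∈ B j} := by
  obtain ⟨-, -, -, -, hA, H⟩ := h
  obtain ⟨m, φ, hφ, e⟩ := PiPred.exists_formula hQ
  have hcut : ∀ N, N ⊆ Vtop μ x →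
      (Models N (fun i : Fin m => B i ∩ {a | a ∈ Vtop μ x}) φ ↔
        Q N fun j => {a | (a : ZFSet.{u}) ∈ B j}) := by
    intro N hN
    rw [← e, Models]
    have : (fun i : Fin m => {a : N | (a : ZFSet.{u}) ∈ B i ∩ {a | a ∈ Vtop μ x}}) =
        fun i : Fin m => {a : N | (a : ZFSet.{u}) ∈ B i} := by
      funext i
      ext a
      simpa using fun _ => hN a.2
    rw [this]
  obtain ⟨y, hy, hyμ, hM⟩ := H m _ φ (fun i => Set.inter_subset_right) hφ
    ((hcut _ fun _ h => h).2 hB)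
  have hyP : y ∈ P μ x := hA hy
  have hle : kap μ y ≤ μ := by
    have := ZFSet.card_mono (x := y ∩ cardSet μ) (y := cardSet μ)
      fun a ha => (ZFSet.mem_inter.1 ha).2
    rwa [card_cardSet] at this
  exact ⟨y, hy, hyP, hyμ, (hcut _ (Vtop_subset_Vtop hle (mem_P.1 hyP).1)).1 hM⟩

/-- If `a < μ` were missing from `x`, take `b ⊆ x` of size `|a| + 1` omitting `∅`; such a `b` is not
an ordinal. Reflecting that the predicate `{b}` is nonempty gives `y` with `b ∈ V_ν(ν, y)`. As `b ∉
y`, its size is below `ν`, so `a ∈ ν = y ∩ μ ⊆ x` after all. -/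
theorem Indescribable.cardSet_subset (h : Indescribable μ x ξ A) (hx : ∀ a ∈ x, a.IsOrdinal) :
    cardSet μ ⊆ x := by
  intro a ha
  by_contra hax
  have hμ : ℵ₀ ≤ μ := h.2.1.le
  have hsucc : ∀ {c : Cardinal.{u}}, c < μ → c + 1 < μ := fun hc =>
    add_lt_of_lt hμ hc (one_lt_aleph0.trans_le hμ)
  have hdiff : μ ≤ (x \ {∅}).card := by
    by_contra! hlt
    refine (hsucc hlt).not_ge (h.2.2.1.trans ?_)
    refine (ZFSet.card_mono (y := insert ∅ (x \ {∅})) fun b hb => ?_).trans ZFSet.card_insert_le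
    by_cases hb0 : b = ∅ <;> simp [hb0, hb]
  have hac := hsucc (mem_cardSet.1 ha).2
  obtain ⟨b, hbx, hb⟩ := exists_subset_card_eq (hac.le.trans hdiff)
  have hbord : ¬ b.IsOrdinal := by
    intro ho
    rw [← ho.toZFSet_rank_eq] at hb hbx
    have h0 : b.rank ≠ 0 := by
      intro h0
      rw [h0] at hb
      simp [eq_comm (a := (0 : Cardinal.{u}))] at hb
    have := hbx (Ordinal.toZFSet_mem_toZFSet_iff.2 (pos_iff_ne_zero.2 h0))
    simp at this
  have hF : FO.{u} 0 fun N R _ => ∃ a : N, a ∈ R 0 := FO.ex (FO.pred 0 _)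
  have hbP : b ∈ P μ x :=
    mem_P.2 ⟨fun c hc => (ZFSet.mem_sdiff.1 (hbx hc)).1, by rwa [hb]⟩
  obtain ⟨y, -, hyP, hy, ⟨c, hc⟩, hcb⟩ := h.reflects (PiPred.fo (P := fun N R => ∃ a : N, a ∈ R 0)
    hF ξ) (fun _ => {b}) ⟨⟨b, P_subset_Vtop hbP⟩, rfl⟩
  obtain rfl : c = b := hcb
  rcases mem_V.1 hc with hcy | ⟨β, -, hcP⟩
  · exact hbord (hx c ((mem_P.1 hyP).1 hcy))
  · have hlt := (mem_P.1 hcP).2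
    rw [hb] at hlt
    have : a ∈ cardSet (kap μ y) :=
      mem_cardSet.2 ⟨(mem_cardSet.1 ha).1, le_self_add.trans_lt hlt⟩
    rw [← hy] at this
    exact hax ((mem_P.1 hyP).1 (ZFSet.mem_inter.1 this).1)

/-- Otherwise some set `t` of subsets of a `c < μ` is in bijection `e` with `μ`. Reflect that `c` is
present and that every member of `t` has an `e`-value. If `c < ν`, every member of `t` lies in
`V_ν(ν, y)`, hence so do all their values; thus `μ ⊆ y`, against `|y| < μ`. -/
theorem Indescribable.isStrongLimit (h : Indescribable μ x ξ A) (hx : ∀ a ∈ x, a.IsOrdinal) :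
    μ.IsStrongLimit := by
  have hμ : ℵ₀ ≤ μ := h.2.1.le
  have hμx := h.cardSet_subset hx
  have hself : Candidate μ x μ x := ⟨hx, fun _ h => h, ZFSet.inter_eq_right_of_subset hμx⟩
  refine ⟨(aleph0_pos.trans_le hμ).ne', fun c hc => ?_⟩
  by_contra! hle
  obtain ⟨t, ht, htμ⟩ := exists_subset_card_eq (s := (cardSet c).powerset) (c := μ)
    (by rwa [ZFSet.card_powerset, card_cardSet])
  obtain ⟨e⟩ : Nonempty (t ≃ cardSet μ) := by
    rw [← Cardinal.eq, ZFSet.cardinalMk_coe_sort, ZFSet.cardinalMk_coe_sort, htμ, card_cardSet]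
  have hcμ : cardSet c ∈ cardSet μ := toZFSet_mem_cardSet.2 (ord_lt_ord.2 hc)
  have htP : ∀ (ν : Cardinal.{u}) (y : ZFSet.{u}), cardSet ν ⊆ y → cardSet c ∈ cardSet ν →
      ∀ r ∈ t, r ∈ Vtop ν y := by
    intro ν y hy hcν r hr
    have hrc := ZFSet.mem_powerset.1 (ht hr)
    refine P_subset_Vtop (mem_P.2 ⟨?_, ?_⟩)
    · exact hrc.trans (((isOrdinal_cardSet ν).subset_of_mem hcν).trans hy)
    · refine (ZFSet.card_mono hrc).trans_lt ?_
      exact (mem_cardSet.1 hcν).2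
  let G : Set ZFSet.{u} := {p | ∃ r : t, p = ZFSet.pair r (e r)}
  have hG : ∀ p ∈ G, ∃ a b, p = ZFSet.pair a b := by
    rintro _ ⟨r, rfl⟩
    exact ⟨_, _, rfl⟩
  have hF : FO.{u} 0 fun N R _ => (∃ a : N, a ∈ R 1) ∧
      ∀ a : N, a ∈ R 0 → ∃ b : N, Related N (R 2) a b :=
    (FO.ex (FO.pred 1 _)).and (FO.all ((FO.pred 0 _).imp (FO.ex (FO.related 2 _ _))))
  obtain ⟨y, -, hyP, hy, ⟨a, ha⟩, H⟩ := h.reflects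
    (PiPred.fo (P := fun N R => (∃ a : N, a ∈ R 1) ∧
      ∀ a : N, a ∈ R 0 → ∃ b : N, Related N (R 2) a b) hF ξ)
    (fun j => if j = 0 then {r | r ∈ t} else if j = 1 then {cardSet c} else G) (by
      refine ⟨⟨⟨_, subset_Vtop _ _ (hμx hcμ)⟩, rfl⟩, fun r hr => ?_⟩
      exact ⟨⟨_, subset_Vtop _ _ (hμx (e ⟨r, hr⟩).2)⟩,
        (related_iff hself hμ hμ hG).2 ⟨⟨r, hr⟩, rfl⟩⟩)
  have hcand : Candidate μ x (kap μ y) y := ⟨hx, (mem_P.1 hyP).1, hy⟩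
  have hcν : cardSet c ∈ cardSet (kap μ y) := by
    rw [← hcand.mem_Vtop_and_mem_cardSet]
    have : (a : ZFSet.{u}) = cardSet c := ha
    exact ⟨this ▸ a.2, hcμ⟩
  refine (mem_P.1 hyP).2.not_ge ?_
  rw [← card_cardSet μ]
  refine ZFSet.card_mono fun b hb => ?_
  obtain ⟨r, hr⟩ := e.surjective ⟨b, hb⟩
  obtain ⟨b', hb'⟩ := H ⟨r, htP _ y hcand.cardSet_subset hcν r r.2⟩ r.2
  obtain ⟨r', h'⟩ := pair_mem_of_related hcand hμ hG hb'
  obtain ⟨h1, h2⟩ := ZFSet.pair_inj.1 h'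
  obtain rfl : r = r' := Subtype.ext h1
  rw [hr] at h2
  have h3 : b ∈ Vtop (kap μ y) y := (show (b' : ZFSet.{u}) = b from h2) ▸ b'.2
  exact hcand.cardSet_subset (hcand.mem_Vtop_and_mem_cardSet.1 ⟨h3, hb⟩)

end Indescribability

/-! ### Reflection of stationarity -/

theorem sStat_image_iff {κ μ ν : Cardinal.{u}} {X x x₀ y : ZFSet.{u}} (hs : Setting κ X μ x x₀)
    (hc : Candidate μ x ν y) {α : Ordinal.{u}} {S : Set ZFSet.{u}} :
    SStat κ X α (y ∩ x₀) (Subtype.val '' {a : Vtop ν y | (a : ZFSet.{u}) ∈ S}) ↔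
      SStat κ X α (y ∩ x₀) S := by
  refine SStat.congr fun z hz => ⟨?_, fun h => ⟨⟨z, ?_⟩, h, rfl⟩⟩
  · rintro ⟨a, ha, rfl⟩
    exact ha
  · exact ((strongSubset_inter_iff hs hc).1 hz).1

/-- The graph of the function `β ↦ 2 ^ |β|` on the ordinals below `μ`. -/
def powGraph (μ : Cardinal.{u}) : Set ZFSet.{u} :=
  {p | ∃ β < μ.ord, p = ZFSet.pair β.toZFSet (cardSet (2 ^ β.card))}

theorem Indescribable.exists_sStat {κ μ : Cardinal.{u}} {X x x₀ : ZFSet.{u}} {ξ : Ordinal.{u}}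
    {A : Set ZFSet.{u}} (h : Indescribable μ x ξ A) (hs : Setting κ X μ x x₀) {ζ : Ordinal.{u}}
    (hζ : ζ ≤ ξ) {S T : Set ZFSet.{u}} (hS : SStat κ X ζ x₀ S) (hT : SStat κ X ζ x₀ T) :
    ∃ y ∈ A, Candidate μ x (kap μ y) y ∧ SStat κ X ζ (y ∩ x₀) S ∧ SStat κ X ζ (y ∩ x₀) T := by
  have hμ := hs.aleph0_le
  have hlim := h.isStrongLimit hs.ordinals
  have hself := hs.candidate_self
  have hζμ : ζ < μ.ord := hζ.trans_lt h.2.2.2.1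
  obtain ⟨Q, hQ, hd⟩ := statDefinable hs ξ
  -- This guard, reflected along with the two stationarity statements, ensures `ζ < ν` and that `ν`
  -- is a strong limit: exactly what correctness of the formulas at `y` requires.
  have hF : FO.{u} 0 fun N R _ => (∃ a : N, a ∈ R 5 ∧ a ∈ R 0) ∧
      ∀ a : N, a ∈ R 0 → ∃ b : N, b ∈ R 0 ∧ Related N (R 4) a b :=
    (FO.ex ((FO.pred 5 _).and (FO.pred 0 _))).and
      (FO.all ((FO.pred 0 _).imp (FO.ex ((FO.pred 0 _).and (FO.related 4 _ _)))))
  -- The formula is used twice; replacing variable `6` by `7` makes the second copy speak about `T`.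
  have hpi := PiPred.fo_and_and (F := fun N R => (∃ a : N, a ∈ R 5 ∧ a ∈ R 0) ∧
      ∀ a : N, a ∈ R 0 → ∃ b : N, b ∈ R 0 ∧ Related N (R 4) a b) hF
    (fun N R h => ⟨h.1.choose⟩) hQ (PiPred.rename hQ fun j => if j = 6 then 7 else j)
  let B : ℕ → Set ZFSet.{u} := fun j => if j < 4 then basePred κ X μ x₀ j else
    if j = 4 then powGraph μ else if j = 5 then {ζ.toZFSet} else if j = 6 then S else T
  have hG : ∀ p ∈ powGraph μ, ∃ a b, p = ZFSet.pair a b := by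
    rintro _ ⟨β, -, rfl⟩
    exact ⟨_, _, rfl⟩
  have hQs : ∀ (ν : Cardinal.{u}) (y : ZFSet.{u}), Candidate μ x ν y → ν.IsStrongLimit →
      ζ < ν.ord →
      (Q (Vtop ν y) (fun j => {a | (a : ZFSet.{u}) ∈ B j}) ↔ SStat κ X ζ (y ∩ x₀) S) ∧
      (Q (Vtop ν y) ((fun j => {a | (a : ZFSet.{u}) ∈ B j}) ∘ fun j => if j = 6 then 7 else j) ↔
        SStat κ X ζ (y ∩ x₀) T) := by
    intro ν y hc hν hζν
    constructor
    · rw [hd ν y hc hν _ (fun j hj => by simp [B, hj]) ζ hζν hζ (by simp [B, code])]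
      exact sStat_image_iff hs hc
    · rw [hd ν y hc hν _ (fun j hj => by
        have : j ≠ 6 := by omega
        simp [B, hj, this]) ζ hζν hζ (by simp [B, code])]
      exact sStat_image_iff hs hc
  have hx : x ∩ x₀ = x₀ := ZFSet.inter_eq_right_of_subset hs.subset
  have hμV : cardSet μ ⊆ Vtop μ x := hself.cardSet_subset.trans (subset_Vtop μ x)
  have hxs := hQs μ x hself hlim hζμ
  rw [hx] at hxs
  obtain ⟨y, hyA, hyP, hy, ⟨⟨a, ha, ha0⟩, hpow⟩, h1, h2⟩ := h.reflects hpi B (by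
    refine ⟨⟨⟨⟨_, toZFSet_mem hμV hζμ⟩, rfl, toZFSet_mem_cardSet.2 hζμ⟩, fun a ha => ?_⟩,
      hxs.1.2 hS, hxs.2.2 hT⟩
    obtain ⟨β, hβ, e⟩ := Ordinal.mem_toZFSet_iff.1 (show (a : ZFSet.{u}) ∈ μ.ord.toZFSet from ha)
    have hβμ : cardSet (2 ^ β.card) ∈ cardSet μ :=
      toZFSet_mem_cardSet.2 (ord_lt_ord.2 (hlim.isStrongPrelimit (lt_ord.1 hβ)))
    refine ⟨⟨_, hμV hβμ⟩, hβμ, (related_iff hself hμ hμ hG).2 ⟨β, hβ, ?_⟩⟩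
    rw [e])
  have hc : Candidate μ x (kap μ y) y := ⟨hs.ordinals, (mem_P.1 hyP).1, hy⟩
  have hζν : ζ < (kap μ y).ord := by
    rw [← toZFSet_mem_cardSet, ← hc.mem_Vtop_and_mem_cardSet]
    have e : (a : ZFSet.{u}) = ζ.toZFSet := ha
    exact ⟨e ▸ a.2, toZFSet_mem_cardSet.2 hζμ⟩
  have hν : (kap μ y).IsStrongLimit := by
    refine ⟨fun h0 => ?_, fun c hcν => ?_⟩
    · rw [h0] at hζν
      simp at hζν
    · have hmem := toZFSet_mem_cardSet.2 (ord_lt_ord.2 hcν)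
      rw [← hc.mem_Vtop_and_mem_cardSet] at hmem
      obtain ⟨b, hb, hr⟩ := hpow ⟨_, hmem.1⟩ hmem.2
      obtain ⟨β, hβ, e⟩ := pair_mem_of_related hc hμ hG hr
      obtain ⟨h3, h4⟩ := ZFSet.pair_inj.1 e
      have h5 : β = c.ord := (Ordinal.toZFSet_injective h3).symm
      have h6 := (hc.mem_Vtop_and_mem_cardSet.1 ⟨b.2, hb⟩)
      rw [h4, h5, card_ord] at h6
      exact ord_lt_ord.1 (toZFSet_mem_cardSet.1 h6)
  have hys := hQs _ y hc hν hζν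
  exact ⟨y, hyA, hc, hys.1.1 h1, hys.2.1 h2⟩

theorem Indescribable.sStat_add_one {κ μ : Cardinal.{u}} {X x x₀ : ZFSet.{u}} {ξ : Ordinal.{u}}
    {A : Set ZFSet.{u}} (h : Indescribable μ x ξ A) (hs : Setting κ X μ x x₀) :
    SStat κ X (ξ + 1) x₀ ((· ∩ x₀) '' A) := by
  have hkap : kap κ x₀ = μ := by rw [kap, hs.inter, card_cardSet]
  refine (sStat_pos_iff (Order.bot_lt_succ ξ).ne' hs.mem).2
    ⟨hkap ▸ (h.isStrongLimit hs.ordinals).isSuccLimit, fun ζ hζ S T hS hT => ?_⟩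
  obtain ⟨y, hyA, -, h1, h2⟩ := h.exists_sStat hs (Order.lt_add_one_iff.1 hζ) hS hT
  refine ⟨_, ⟨y, hyA, rfl⟩, ⟨fun a ha => (ZFSet.mem_inter.1 ha).2, ?_⟩, h1, h2⟩
  rw [hkap]
  exact (ZFSet.card_mono fun a ha => (ZFSet.mem_inter.1 ha).1).trans_lt
    (mem_P.1 (h.2.2.2.2.1 hyA)).2

end TwoCardinal

end

-- The corollary

theorem mainTheorem5 (κ : Cardinal.{u}) (hκ : κ.IsRegular) (hκ' : ℵ₀ < κ)
    (X : ZFSet.{u}) (hX : ∀ a ∈ X, a.IsOrdinal) (hκX : TwoCardinal.cardSet κ ⊆ X)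
    (ξ : Ordinal.{u}) :
    (∀ x ∈ TwoCardinal.P κ X,
      x ∩ TwoCardinal.cardSet κ = TwoCardinal.cardSet (TwoCardinal.kap κ x) →
      ∀ A : Set ZFSet.{u}, A ⊆ {y | y ∈ TwoCardinal.P (TwoCardinal.kap κ x) x} →
        TwoCardinal.Indescribable (TwoCardinal.kap κ x) x ξ A →
        TwoCardinal.SStat κ X (ξ + 1) x A) ∧
    ((∃ x ∈ TwoCardinal.P κ X,
        TwoCardinal.Indescribable (TwoCardinal.kap κ x) x ξ
          {y | y ∈ TwoCardinal.P (TwoCardinal.kap κ x) x}) →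
      ¬ @DiscreteTopology (TwoCardinal.Space κ X) (TwoCardinal.tau κ X (ξ + 1))) := by
  constructor
  · intro x hx hxκ A hA h
    have hs : TwoCardinal.Setting κ X (TwoCardinal.kap κ x) x x :=
      ⟨fun a ha => hX a ((TwoCardinal.mem_P.1 hx).1 ha), fun _ ha => ha, hxκ, hx, h.2.1.le⟩
    have e : (· ∩ x) '' A = A := by
      refine (Set.image_congr fun y hy => ?_).trans (Set.image_id A)
      exact ZFSet.inter_eq_left_of_subset (TwoCardinal.mem_P.1 (hA hy)).1
    exact e ▸ h.sStat_add_one hs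
  · rintro ⟨x, hx, h⟩
    have hxX := TwoCardinal.mem_P.1 hx
    have hord : ∀ a ∈ x, a.IsOrdinal := fun a ha => hX a (hxX.1 ha)
    have hsub := h.cardSet_subset hord
    have hlt : TwoCardinal.kap κ x < κ := (TwoCardinal.kap_le_card x).trans_lt hxX.2
    -- The limit point is the cardinal `κ_x` instead of `x`: its intersection with `κ` is itself,
    -- whatever the shape of `x ∩ κ`.
    have hs : TwoCardinal.Setting κ X (TwoCardinal.kap κ x) x
        (TwoCardinal.cardSet (TwoCardinal.kap κ x)) :=
      { ordinals := hord
        subset := hsub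
        inter := ZFSet.inter_eq_left_of_subset ((TwoCardinal.isOrdinal_cardSet κ).subset_of_mem
          (TwoCardinal.toZFSet_mem_cardSet.2 (Cardinal.ord_lt_ord.2 hlt)))
        mem := TwoCardinal.mem_P.2 ⟨hsub.trans hxX.1, by rwa [TwoCardinal.card_cardSet]⟩
        aleph0_le := h.2.1.le }
    exact TwoCardinal.not_discreteTopology hs.mem (h.sStat_add_one hs)
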